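/- Let $\mu:(0,1)\to[0,\infty)$ be integrable with $\int_0^1\mu(\alpha)\,d\alpha>0$. For $\alpha\in(0,1)$ let $$D^{\alpha}f(t)=\frac{1}{\Gamma(1-\alpha)}\frac{d}{dt}\int_0^t (t-\tau)^{-\alpha}\,\bigl(f(\tau)-f(0)\bigr)\,d\tau ,\qquad D^{(\mu)}f(t)=\int_0^1 (D^{\alpha}f)(t)\,\mu(\alpha)\,d\alpha$$ be the Caputo derivative and the distributed order Caputo derivative. Let $$g(t)=\frac1\pi\int_0^\infty e^{-rt}\,\frac{S(r)}{C(r)^2+S(r)^2}\,dr,\qquad S(r)=\int_0^1\sin(\pi\alpha)\,r^{\alpha}\mu(\alpha)\,d\alpha,\quad C(r)=\int_0^1\cos(\pi\alpha)\,r^{\alpha}\mu(\alpha)\,d\alpha$$ be the resolvent kernel of $D^{(\mu)}$. Write $(g*h)(t)=\int_0^t g(t-\tau)h(\tau)\,d\tau$ and let $g^{[k]}*h=g*\dots*g*h$ with $g$ taken $k$ times (so $g^{[0]}*h=h$). Then $g$ is locally integrable on $[0,\infty)$, and for all $v_0,\lambda\in\mathbb{C}$ the following holds. (1) The series $\sum_{k=0}^\infty(-\lambda)^k\,g^{[k]}*1$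 converges at every $t\ge 0$; it converges absolutely in the Sobolev space $W^{1,1}(0,T)$, and to its pointwise sum in that space, for every $T>0$. (2) The function $$v(t)=v_0\sum_{k=0}^{\infty}(-\lambda)^k\,(g^{[k]}*1)(t),\qquad t\ge 0,$$ is absolutely continuous on $[0,T]$ for every $T>0$, $D^{(\mu)}v(t)$ is well defined for almost every $t>0$, and $v$ solves $$D^{(\mu)}v(t)+\lambda v(t)=0\ \text{ for almost every } t>0,\qquad v(0)=v_0 .$$ (3) This solution is unique: for every $T>0$, every absolutely continuous $w:[0,T]\to\mathbb{C}$ with $w(0)=v_0$ and $D^{(\mu)}w+\lambda w=0$ almost everywhere on $(0,T)$ coincides with $v$ on $[0,T]$. -/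

import Mathlib

open Set Filter Topology MeasureTheory
open scoped ENNReal ContDiff

namespace DistOrder

noncomputable section

/-- Riemann-Liouville fractional integral
`(I^β f)(t) = Γ(β)⁻¹ ∫₀ᵗ (t - τ)^(β - 1) f(τ) dτ`, for `β > 0`. -/
def rlIntegral (β : ℝ) (f : ℝ → ℂ) (t : ℝ) : ℂ :=
  (Real.Gamma β)⁻¹ • ∫ τ in (0 : ℝ)..t, ((t - τ) ^ (β - 1) : ℝ) • f τ

/-- Riemann-Liouville derivative `∂^α f = d/dt I^(1-α) f`, for `0 < α < 1`. -/
def rlDeriv (α : ℝ) (f : ℝ → ℂ) (t : ℝ) : ℂ :=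
  deriv (rlIntegral (1 - α) f) t

/-- Caputo derivative `D^α f = ∂^α [f - f(0)]`, for `0 < α < 1`. -/
def caputoDeriv (α : ℝ) (f : ℝ → ℂ) (t : ℝ) : ℂ :=
  rlDeriv α (fun s => f s - f 0) t

/-- Distributed order Caputo derivative `(D^(μ) f)(t) = ∫₀¹ (D^α f)(t) μ(α) dα`. -/
def distCaputo (μ : ℝ → ℝ) (f : ℝ → ℂ) (t : ℝ) : ℂ :=
  ∫ α in Ioo (0 : ℝ) 1, μ α • caputoDeriv α f t

/-- `(D^(μ) f)(t)` is genuinely defined: for almost every `α ∈ (0,1)` the function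
`I^(1-α)[f - f(0)]` is differentiable at `t`, and `α ↦ (D^α f)(t) μ(α)` is integrable on `(0,1)`. -/
def DistCaputoDefinedAt (μ : ℝ → ℝ) (f : ℝ → ℂ) (t : ℝ) : Prop :=
  (∀ᵐ α ∂(volume.restrict (Ioo (0 : ℝ) 1)),
      DifferentiableAt ℝ (rlIntegral (1 - α) (fun s => f s - f 0)) t) ∧
    IntegrableOn (fun α => μ α • caputoDeriv α f t) (Ioo (0 : ℝ) 1)

/-- `v` is an absolutely continuous solution on `[0,T]` of `D^(μ) v + lam v = 0`, `v(0) = v₀`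
(the equation holds almost everywhere on `(0,T)`). -/
structure IsACSolution (μ : ℝ → ℝ) (lam v₀ : ℂ) (T : ℝ) (v : ℝ → ℂ) : Prop where
  ac : AbsolutelyContinuousOnInterval v 0 T
  init : v 0 = v₀
  eqn : ∀ᵐ t ∂(volume.restrict (Ioo (0 : ℝ) T)), distCaputo μ v t + lam * v t = 0

/-- The resolvent kernel `g` of the distributed order derivative:
`g(t) = π⁻¹ ∫₀^∞ e^(-rt) S(r) / (C(r)² + S(r)²) dr`, where
`S(r) = ∫₀¹ sin(πα) r^α μ(α) dα` and `C(r) = ∫₀¹ cos(πα) r^α μ(α) dα`. -/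
def resolventKernel (μ : ℝ → ℝ) (t : ℝ) : ℝ :=
  1 / Real.pi * ∫ r in Ioi (0 : ℝ), Real.exp (-(r * t)) *
    ((∫ α in Ioo (0 : ℝ) 1, Real.sin (Real.pi * α) * r ^ α * μ α) /
      ((∫ α in Ioo (0 : ℝ) 1, Real.cos (Real.pi * α) * r ^ α * μ α) ^ 2 +
        (∫ α in Ioo (0 : ℝ) 1, Real.sin (Real.pi * α) * r ^ α * μ α) ^ 2))

/-- Convolution on the half-line, `(g * h)(t) = ∫₀ᵗ g(t - τ) h(τ) dτ`. -/
def conv (g h : ℝ → ℝ) (t : ℝ) : ℝ :=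
  ∫ τ in (0 : ℝ)..t, g (t - τ) * h τ

/-- `g^[k] * h = g * (g * ⋯ (g * h))`, with `g` taken `k` times. -/
def iterConv (g : ℝ → ℝ) (k : ℕ) (h : ℝ → ℝ) : ℝ → ℝ :=
  (conv g)^[k] h

/-- The `k`-th term `(-lam)^k g^[k] * 1` of the series, `g` being the resolvent kernel. -/
def seriesTerm (μ : ℝ → ℝ) (lam : ℂ) (k : ℕ) (t : ℝ) : ℂ :=
  (-lam) ^ k * ((iterConv (resolventKernel μ) k (fun _ => 1) t : ℝ) : ℂ)

/-- The pointwise sum `∑ₖ (-lam)^k (g^[k] * 1)(t)`. -/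
def seriesSum (μ : ℝ → ℝ) (lam : ℂ) (t : ℝ) : ℂ :=
  ∑' k : ℕ, seriesTerm μ lam k t

/-- `f, f' ∈ L¹(0,T)` and `f'` is the weak derivative of `f` on `(0,T)`. -/
structure HasWeakDerivL1 (T : ℝ) (f f' : ℝ → ℂ) : Prop where
  integrable : IntegrableOn f (Ioo (0 : ℝ) T)
  integrable_deriv : IntegrableOn f' (Ioo (0 : ℝ) T)
  integral_eq : ∀ φ : ℝ → ℝ, ContDiff ℝ ∞ φ → HasCompactSupport φ → tsupport φ ⊆ Ioo (0 : ℝ) T →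
    ∫ t in Ioo (0 : ℝ) T, deriv φ t • f t = -∫ t in Ioo (0 : ℝ) T, φ t • f' t

/-- The norm `‖f‖_{L¹(0,T)} + ‖f'‖_{L¹(0,T)}` of the Sobolev space `W^{1,1}(0,T)`, where `f'` is
the (almost everywhere unique) weak derivative. It is `⊤` exactly when `f ∉ W^{1,1}(0,T)`. -/
def w11Norm (T : ℝ) (f : ℝ → ℂ) : ℝ≥0∞ :=
  ⨅ (f' : ℝ → ℂ) (_ : HasWeakDerivL1 T f f'),
    ((∫⁻ t in Ioo (0 : ℝ) T, ‖f t‖ₑ) + ∫⁻ t in Ioo (0 : ℝ) T, ‖f' t‖ₑ)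

end

end DistOrder

/-! Write Φ(p) = ∫ p^α μ(α) dα and k(t) = ∫ t^(-α)/Γ(1-α) μ(α) dα. For absolutely continuous w one
has D^(μ) w = k * w' almost everywhere (`ae_distCaputo_eq`), and k has Laplace transform Φ(p)/p.

The crux is that g has Laplace transform 1/Φ(p) (`lap_resKer`), that is, 1/Φ(p) = π⁻¹ ∫ S/(C² + S²)
dr/(r + p) (`lintegral_specDens_log`). With p = e^z, Φ becomes the entire function `symb`, the plane
cut along the negative axis becomes the strip |Im z| ≤ π, and C ± iS are the values on its two
edges. On the strip |Φ(e^(x+iy))| ≥ S(e^x) > 0. Cauchy's theorem is applied to 1/Φ minus the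
multiple of e^(-z/2) that cancels the pole at z = c; the subtracted term integrates to an arctangent
and contributes π/Φ(e^c).

Uniqueness of Laplace transforms turns Φ(p)/p · 1/Φ(p) = 1/p into k * g = 1 (`capKer_lconv_resKer`),
so the problem amounts to v = v₀ - λ g * v, whose Neumann series is the given one. Since Φ(σ) → ∞,
some σ has |λ|/Φ(σ) ≤ 1/2. In L¹ with weight e^(-σt) the derivatives (-λ)^(j+1) g^[j] * g of the
terms are then dominated by a geometric series. This gives convergence in W^{1,1}, absolute
continuity, and termwise application of k, which by k * g = 1 removes one factor g and yields the
equation. For uniqueness, a difference U of solutions satisfies U = -λ g * U, so the maximum of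
e^(-σt)|U| is at most half of itself.

Kernels take values in `ℝ≥0∞`, where Tonelli needs no integrability; acting on complex functions
through `cconv` costs a finiteness condition. -/

namespace DistOrder

noncomputable section

/-! ### Laplace transforms, convolutions and uniqueness of the transform. -/

section

/-- The Laplace transform of a nonnegative function. -/
def lap (f : ℝ → ℝ≥0∞) (p : ℝ) : ℝ≥0∞ := ∫⁻ t, f t * ENNReal.ofReal (Real.exp (-(p * t)))

/-- The Heaviside function. -/
def heav : ℝ → ℝ≥0∞ := (Ioi 0).indicator 1

lemma measurable_heav : Measurable heav := measurable_one.indicator measurableSet_Ioi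

/-- Tonelli and translation invariance; infinite values are allowed on both sides. -/
lemma lap_lconvolution {f h : ℝ → ℝ≥0∞} (hf : Measurable f) (hh : Measurable h) (p : ℝ) :
    lap (f ⋆ₗ h) p = lap f p * lap h p := by
  have key : ∀ t s : ℝ, f s * h (-s + t) * ENNReal.ofReal (Real.exp (-(p * t))) =
      (f s * ENNReal.ofReal (Real.exp (-(p * s)))) *
        (h (-s + t) * ENNReal.ofReal (Real.exp (-(p * (-s + t))))) := by
    intro t s
    have : Real.exp (-(p * t)) = Real.exp (-(p * s)) * Real.exp (-(p * (-s + t))) := by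
      rw [← Real.exp_add]; congr 1; ring
    rw [this, ENNReal.ofReal_mul (Real.exp_pos _).le]
    ring
  unfold lap
  simp_rw [lconvolution_def]
  calc ∫⁻ t, (∫⁻ s, f s * h (-s + t)) * ENNReal.ofReal (Real.exp (-(p * t)))
      = ∫⁻ t, ∫⁻ s, f s * h (-s + t) * ENNReal.ofReal (Real.exp (-(p * t))) := by
        refine lintegral_congr fun t => ?_
        rw [lintegral_mul_const]
        fun_prop
    _ = ∫⁻ s, ∫⁻ t, f s * h (-s + t) * ENNReal.ofReal (Real.exp (-(p * t))) := by
        rw [lintegral_lintegral_swap]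
        fun_prop
    _ = ∫⁻ s, (f s * ENNReal.ofReal (Real.exp (-(p * s)))) *
          ∫⁻ t, h t * ENNReal.ofReal (Real.exp (-(p * t))) := by
        refine lintegral_congr fun s => ?_
        simp_rw [key _ s]
        rw [lintegral_const_mul _ (by fun_prop),
          lintegral_add_left_eq_self (fun t => h t * ENNReal.ofReal (Real.exp (-(p * t)))) (-s)]
    _ = _ := by rw [lintegral_mul_const]; fun_prop

/-- Convolution of a nonnegative kernel with a complex function. -/
def cconv (A : ℝ → ℝ≥0∞) (f : ℝ → ℂ) (t : ℝ) : ℂ := ∫ s, (A (t - s)).toReal • f s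

lemma lconv_eq_sub (A B : ℝ → ℝ≥0∞) (t : ℝ) : (A ⋆ₗ B) t = ∫⁻ s, A (t - s) * B s := by
  rw [lconvolution_comm, lconvolution_def]
  exact lintegral_congr fun s => by rw [mul_comm, neg_add_eq_sub]

lemma cconv_integrand_integrable {A : ℝ → ℝ≥0∞} (hA : Measurable A) {f : ℝ → ℂ}
    (hf : AEStronglyMeasurable f) {t : ℝ} (h : (A ⋆ₗ fun s => ‖f s‖ₑ) t ≠ ⊤) :
    Integrable (fun s => (A (t - s)).toReal • f s) := by
  have hm : Measurable fun s => (A (t - s)).toReal := by fun_prop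
  refine ⟨hm.aestronglyMeasurable.smul hf, ?_⟩
  rw [lconv_eq_sub] at h
  refine lt_of_le_of_lt (lintegral_mono fun s => ?_) h.lt_top
  rw [enorm_smul]
  gcongr
  rw [Real.enorm_of_nonneg ENNReal.toReal_nonneg]
  exact ENNReal.ofReal_toReal_le

lemma enorm_cconv_le (A : ℝ → ℝ≥0∞) (f : ℝ → ℂ) (t : ℝ) :
    ‖cconv A f t‖ₑ ≤ (A ⋆ₗ fun s => ‖f s‖ₑ) t := by
  rw [lconv_eq_sub]
  refine (enorm_integral_le_lintegral_enorm _).trans (lintegral_mono fun s => ?_)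
  rw [enorm_smul]
  gcongr
  rw [Real.enorm_of_nonneg ENNReal.toReal_nonneg]
  exact ENNReal.ofReal_toReal_le

/-- Fubini at the single point t: the hypothesis is exactly the absolute convergence of the double
integral. -/
lemma cconv_assoc {A B : ℝ → ℝ≥0∞} (hA : Measurable A) (hB : Measurable B) {f : ℝ → ℂ}
    (hf : AEStronglyMeasurable f) {t : ℝ} (h : ((A ⋆ₗ B) ⋆ₗ fun s => ‖f s‖ₑ) t ≠ ⊤) :
    cconv A (cconv B f) t = cconv (A ⋆ₗ B) f t := by
  have hAB : Measurable (A ⋆ₗ B) := measurable_lconvolution _ hA hB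
  have hshift : ∀ s, (A ⋆ₗ B) (t - s) = ∫⁻ r, A (t - r) * B (r - s) := by
    intro s
    rw [lconv_eq_sub, ← lintegral_sub_right_eq_self _ s]
    exact lintegral_congr fun r => by rw [show t - s - (r - s) = t - r by ring]
  have hmeas : AEStronglyMeasurable
      (fun p : ℝ × ℝ => ((A (t - p.1)).toReal * (B (p.1 - p.2)).toReal) • f p.2)
      (volume.prod volume) := by
    have hf2 : AEStronglyMeasurable (fun p : ℝ × ℝ => f p.2) (volume.prod volume) := hf.comp_snd
    have hAB2 : Measurable fun p : ℝ × ℝ =>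
      (A (t - p.1)).toReal * (B (p.1 - p.2)).toReal := by fun_prop
    exact hAB2.aestronglyMeasurable.smul hf2
  have hfe : AEMeasurable (fun s => ‖f s‖ₑ) := hf.enorm
  have hint : Integrable
      (fun p : ℝ × ℝ => ((A (t - p.1)).toReal * (B (p.1 - p.2)).toReal) • f p.2)
      (volume.prod volume) := by
    refine ⟨hmeas, ?_⟩
    have hle : ∫⁻ p : ℝ × ℝ, ‖((A (t - p.1)).toReal * (B (p.1 - p.2)).toReal) • f p.2‖ₑ
        ∂(volume.prod volume) ≤
        ∫⁻ p : ℝ × ℝ, A (t - p.1) * B (p.1 - p.2) * ‖f p.2‖ₑ ∂(volume.prod volume) := by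
      refine lintegral_mono fun p => ?_
      rw [enorm_smul]
      gcongr
      rw [← ENNReal.toReal_mul, Real.enorm_of_nonneg ENNReal.toReal_nonneg]
      exact ENNReal.ofReal_toReal_le
    refine lt_of_le_of_lt hle ?_
    have hm2 : AEMeasurable (fun p : ℝ × ℝ => A (t - p.1) * B (p.1 - p.2) * ‖f p.2‖ₑ)
        (volume.prod volume) :=
      (by fun_prop : Measurable fun p : ℝ × ℝ => A (t - p.1) * B (p.1 - p.2)).aemeasurable.mul
        (AEMeasurable.comp_snd hfe)
    rw [lintegral_prod_symm _ hm2]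
    refine lt_of_eq_of_lt ?_ h.lt_top
    rw [lconv_eq_sub]
    refine lintegral_congr fun s => ?_
    rw [hshift]
    simp only
    exact lintegral_mul_const _
      (show Measurable fun r : ℝ => A (t - r) * B (r - s) by fun_prop)
  -- Where the inner convolution is infinite, `f` must vanish, so `toReal` loses nothing.
  have hfin : ∀ᵐ s, (A ⋆ₗ B) (t - s) * ‖f s‖ₑ < ⊤ := by
    rw [lconv_eq_sub] at h
    refine ae_lt_top' ?_ h
    exact (by fun_prop : Measurable fun s => (A ⋆ₗ B) (t - s)).aemeasurable.mul hfe
  calc cconv A (cconv B f) t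
      = ∫ r, ∫ s, ((A (t - r)).toReal * (B (r - s)).toReal) • f s := by
        unfold cconv
        refine integral_congr_ae (Eventually.of_forall fun r => ?_)
        simp only
        rw [← integral_smul]
        simp_rw [smul_smul]
    _ = ∫ s, ∫ r, ((A (t - r)).toReal * (B (r - s)).toReal) • f s :=
        integral_integral_swap hint
    _ = cconv (A ⋆ₗ B) f t := by
        refine integral_congr_ae ?_
        filter_upwards [hfin] with s hs
        rw [integral_smul_const]
        by_cases hz : f s = 0
        · simp [hz]
        congr 1
        have hne : (A ⋆ₗ B) (t - s) ≠ ⊤ := by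
          intro htop
          rw [htop, ENNReal.top_mul (by simpa using hz)] at hs
          exact lt_irrefl _ hs
        rw [hshift] at hne ⊢
        simp_rw [← ENNReal.toReal_mul]
        have hm3 : Measurable fun r => A (t - r) * B (r - s) := by fun_prop
        rw [integral_toReal hm3.aemeasurable (ae_lt_top hm3 hne)]

lemma lap_mono {f : ℝ → ℝ≥0∞} (h0 : ∀ t ≤ 0, f t = 0) {p q : ℝ} (hpq : p ≤ q) :
    lap f q ≤ lap f p := by
  refine lintegral_mono fun t => ?_
  rcases le_or_gt t 0 with ht | ht
  · simp [h0 t ht]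
  · gcongr

lemma lap_eq_top_of_nonpos {f : ℝ → ℝ≥0∞} (h0 : ∀ t ≤ 0, f t = 0)
    (h : ∀ p, 0 < p → lap f p = ENNReal.ofReal (1 / p)) {p : ℝ} (hp : p ≤ 0) : lap f p = ⊤ := by
  refine ENNReal.eq_top_of_forall_nnreal_le fun r => ?_
  have hr : (0 : ℝ) < 1 / (r + 1) := by positivity
  calc (r : ℝ≥0∞) ≤ ENNReal.ofReal (1 / (1 / ((r : ℝ) + 1))) := by
        rw [one_div_one_div, ← ENNReal.ofReal_coe_nnreal]
        exact ENNReal.ofReal_le_ofReal (by linarith)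
    _ = lap f (1 / (r + 1)) := (h _ hr).symm
    _ ≤ lap f p := lap_mono h0 (hp.trans hr.le)

lemma lap_heav {p : ℝ} (hp : 0 < p) : lap heav p = ENNReal.ofReal (1 / p) := by
  have h1 : ∀ t, heav t * ENNReal.ofReal (Real.exp (-(p * t))) =
      (Ioi (0 : ℝ)).indicator (fun t => ENNReal.ofReal (Real.exp (-p * t))) t := by
    intro t
    by_cases ht : t ∈ Ioi (0 : ℝ) <;> simp [heav, ht]
  unfold lap
  simp_rw [h1]
  rw [lintegral_indicator measurableSet_Ioi, ← ofReal_integral_eq_lintegral_ofReal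
    (integrableOn_exp_mul_Ioi (by linarith) 0) (Eventually.of_forall fun t => (Real.exp_pos _).le),
    integral_exp_mul_Ioi (by linarith)]
  simp

/-- The finite measure with density `f t * exp (-t)`. -/
def expWeight (f : ℝ → ℝ≥0∞) : Measure ℝ :=
  volume.withDensity fun t => f t * ENNReal.ofReal (Real.exp (-(1 * t)))

lemma mgf_expWeight {f : ℝ → ℝ≥0∞} (hf : Measurable f) (u : ℝ) :
    ProbabilityTheory.mgf id (expWeight f) u = (lap f (1 - u)).toReal := by
  unfold ProbabilityTheory.mgf expWeight
  rw [integral_eq_lintegral_of_nonneg_ae (Eventually.of_forall fun t => (Real.exp_pos _).le)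
    (by fun_prop), lintegral_withDensity_eq_lintegral_mul _ (by fun_prop) (by fun_prop)]
  congr 1
  refine lintegral_congr fun t => ?_
  simp only [Pi.mul_apply, id]
  rw [mul_assoc, ← ENNReal.ofReal_mul (Real.exp_pos _).le, ← Real.exp_add]
  congr 3
  ring

/-- A function on the half-line whose Laplace transform is `1 / p` is the Heaviside function. -/
lemma ae_eq_heav_of_lap {f : ℝ → ℝ≥0∞} (hf : Measurable f) (h0 : ∀ t ≤ 0, f t = 0)
    (h : ∀ p, 0 < p → lap f p = ENNReal.ofReal (1 / p)) : f =ᵐ[volume] heav := by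
  have hH0 : ∀ t ≤ 0, heav t = 0 := fun t ht => by simp [heav, ht]
  have hfin : ∀ F : ℝ → ℝ≥0∞, (∀ p, 0 < p → lap F p = ENNReal.ofReal (1 / p)) →
      ∫⁻ t, F t * ENNReal.ofReal (Real.exp (-(1 * t))) ≠ ⊤ := fun F hF => by
    change lap F 1 ≠ ⊤
    rw [hF 1 one_pos]; exact ENNReal.ofReal_ne_top
  have hfm : ∀ F : ℝ → ℝ≥0∞, (∀ p, 0 < p → lap F p = ENNReal.ofReal (1 / p)) →
      IsFiniteMeasure (expWeight F) := fun F hF =>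
    isFiniteMeasure_withDensity (hfin F hF)
  have hHl : ∀ p, 0 < p → lap heav p = ENNReal.ofReal (1 / p) := fun p => lap_heav
  have := hfm f h
  have := hfm heav hHl
  -- For u ≥ 1 both transforms diverge and both moment generating functions take the default value
  -- 0.
  have hmgf : ProbabilityTheory.mgf id (expWeight f) =
      ProbabilityTheory.mgf id (expWeight heav) := by
    funext u
    rw [mgf_expWeight hf, mgf_expWeight measurable_heav]
    rcases lt_or_ge u 1 with hu | hu
    · rw [h _ (by linarith), hHl _ (by linarith)]
    · rw [lap_eq_top_of_nonpos h0 h (by linarith), lap_eq_top_of_nonpos hH0 hHl (by linarith)]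
  have hne : ∀ F : ℝ → ℝ≥0∞, Measurable F →
      (∀ p, 0 < p → lap F p = ENNReal.ofReal (1 / p)) → expWeight F ≠ 0 := by
    intro F hFm hF h0
    have := mgf_expWeight hFm 0
    rw [h0, hF _ (by norm_num)] at this
    simp at this
  -- A divergent integral would make the moment generating function 0, whereas it equals 1/(1-u) > 0
  -- for u < 1.
  have hint : 0 ∈ interior (ProbabilityTheory.integrableExpSet id (expWeight f)) := by
    rw [mem_interior_iff_mem_nhds]
    filter_upwards [Iio_mem_nhds (show (0 : ℝ) < 1 by norm_num)] with u hu
    by_contra hcon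
    have h1 : ProbabilityTheory.mgf id (expWeight f) u = 0 := integral_undef hcon
    rw [mgf_expWeight hf, h _ (by simpa using hu), ENNReal.toReal_ofReal
      (by simp only [mem_Iio] at hu; rw [one_div, inv_nonneg]; linarith)] at h1
    simp only [mem_Iio] at hu
    have : 0 < 1 / (1 - u) := by rw [one_div, inv_pos]; linarith
    linarith
  -- Analytic continuation to a vertical strip around the imaginary axis, where one reads off the
  -- characteristic functions.
  have hc := ProbabilityTheory.eqOn_complexMGF_of_mgf' hmgf
    ⟨fun h' => absurd h' (hne f hf h), fun h' => absurd h' (hne heav measurable_heav hHl)⟩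
  have hmeas : expWeight f = expWeight heav := by
    refine Measure.ext_of_charFun (funext fun t => ?_)
    rw [← ProbabilityTheory.complexMGF_id_mul_I, ← ProbabilityTheory.complexMGF_id_mul_I]
    exact hc (by simpa using hint)
  unfold expWeight at hmeas
  have hm1 : Measurable fun t : ℝ => ENNReal.ofReal (Real.exp (-(1 * t))) := by fun_prop
  replace hmeas := (withDensity_eq_iff (hf.mul hm1).aemeasurable
    (measurable_heav.mul hm1).aemeasurable (hfin f h)).1 hmeas
  filter_upwards [hmeas] with t ht
  have hpos : ENNReal.ofReal (Real.exp (-(1 * t))) ≠ 0 := by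
    simp [Real.exp_pos]
  exact (ENNReal.mul_left_inj hpos ENNReal.ofReal_ne_top).1 ht

end

/-! ### The symbol Φ in the logarithmic variable, and its lower bounds. -/

section

/-- A finite nonzero measure of orders, carried by `(0,1)`. -/
class OrderMeasure (ν : Measure ℝ) : Prop extends IsFiniteMeasure ν where
  ae_mem : ∀ᵐ α ∂ν, α ∈ Ioo (0 : ℝ) 1
  ne_zero : ν ≠ 0

/-- The symbol `z ↦ ∫ e^(α z) dν(α)` in the logarithmic variable. -/
def symb (ν : Measure ℝ) (z : ℂ) : ℂ := ∫ α, Complex.exp (z * (α : ℝ)) ∂ν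

/-- `∫ e^(α x) dν(α)`. -/
def expT (ν : Measure ℝ) (x : ℝ) : ℝ := ∫ α, Real.exp (α * x) ∂ν

/-- `∫ e^(α x) sin (π α) dν(α)`. -/
def sinT (ν : Measure ℝ) (x : ℝ) : ℝ := ∫ α, Real.exp (α * x) * Real.sin (Real.pi * α) ∂ν

/-- `∫ e^(α x) cos (π α) dν(α)`. -/
def cosT (ν : Measure ℝ) (x : ℝ) : ℝ := ∫ α, Real.exp (α * x) * Real.cos (Real.pi * α) ∂ν

/-- The spectral density of the resolvent kernel in the logarithmic variable. -/
def specDens (ν : Measure ℝ) (x : ℝ) : ℝ := sinT ν x / (cosT ν x ^ 2 + sinT ν x ^ 2)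

lemma symb_ofReal (ν : Measure ℝ) (x : ℝ) : symb ν x = (expT ν x : ℂ) := by
  unfold symb expT
  rw [← integral_complex_ofReal]
  refine integral_congr_ae (Eventually.of_forall fun α => ?_)
  simp [mul_comm]

variable (ν : Measure ℝ) [OrderMeasure ν]

lemma exp_mul_le_exp_abs {α x : ℝ} (hα : α ∈ Ioo (0 : ℝ) 1) :
    Real.exp (α * x) ≤ Real.exp |x| := by
  apply Real.exp_le_exp.2
  calc α * x ≤ |α * x| := le_abs_self _
    _ = α * |x| := by rw [abs_mul, abs_of_pos hα.1]
    _ ≤ 1 * |x| := by gcongr; exact hα.2.le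
    _ = |x| := one_mul _

lemma integrable_of_le_exp {φ : ℝ → ℝ} (hφ : Measurable φ) (x : ℝ)
    (h : ∀ α ∈ Ioo (0 : ℝ) 1, |φ α| ≤ Real.exp (α * x)) : Integrable φ ν := by
  refine Integrable.of_bound hφ.aestronglyMeasurable (Real.exp |x|) ?_
  filter_upwards [OrderMeasure.ae_mem (ν := ν)] with α hα
  exact (h α hα).trans (exp_mul_le_exp_abs hα)

lemma integrable_expT (x : ℝ) : Integrable (fun α => Real.exp (α * x)) ν :=
  integrable_of_le_exp ν (by fun_prop) x fun α _ => by rw [abs_of_pos (Real.exp_pos _)]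

lemma integrable_sinT (x : ℝ) :
    Integrable (fun α => Real.exp (α * x) * Real.sin (Real.pi * α)) ν :=
  integrable_of_le_exp ν (by fun_prop) x fun α _ => by
    rw [abs_mul, abs_of_pos (Real.exp_pos _)]
    exact mul_le_of_le_one_right (Real.exp_pos _).le (Real.abs_sin_le_one _)

lemma integrable_cosT (x : ℝ) :
    Integrable (fun α => Real.exp (α * x) * Real.cos (Real.pi * α)) ν :=
  integrable_of_le_exp ν (by fun_prop) x fun α _ => by
    rw [abs_mul, abs_of_pos (Real.exp_pos _)]
    exact mul_le_of_le_one_right (Real.exp_pos _).le (Real.abs_cos_le_one _)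

/-- `symb` is the complex moment generating function of a measure all of whose exponential moments
are finite. -/
lemma differentiable_symb : Differentiable ℂ (symb ν) := by
  have hset : ProbabilityTheory.integrableExpSet id ν = univ := by
    ext u
    simp only [mem_univ, iff_true]
    change Integrable _ ν
    simpa [mul_comm] using integrable_expT ν u
  have h := ProbabilityTheory.differentiableOn_complexMGF (X := id) (μ := ν)
  simp only [hset, interior_univ, mem_univ] at h
  exact differentiableOn_univ.1 h

lemma sin_pi_mul_pos {α : ℝ} (hα : α ∈ Ioo (0 : ℝ) 1) : 0 < Real.sin (Real.pi * α) :=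
  Real.sin_pos_of_pos_of_lt_pi (mul_pos Real.pi_pos hα.1)
    (by nlinarith [Real.pi_pos, hα.2])

lemma integral_pos_of_pos {φ : ℝ → ℝ} (hi : Integrable φ ν)
    (h : ∀ α ∈ Ioo (0 : ℝ) 1, 0 < φ α) : 0 < ∫ α, φ α ∂ν := by
  have hae : ∀ᵐ α ∂ν, 0 < φ α := by
    filter_upwards [OrderMeasure.ae_mem (ν := ν)] with α hα using h α hα
  rw [integral_pos_iff_support_of_nonneg_ae (hae.mono fun _ => le_of_lt) hi]
  have hs : ν (Function.support φ) = ν univ := by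
    refine measure_congr ?_
    filter_upwards [hae] with α hα
    exact propext ⟨fun _ => trivial, fun _ => hα.ne'⟩
  rw [hs, pos_iff_ne_zero]
  simpa using OrderMeasure.ne_zero (ν := ν)

lemma expT_pos (x : ℝ) : 0 < expT ν x :=
  integral_pos_of_pos ν (integrable_expT ν x) fun _ _ => Real.exp_pos _

lemma sinT_pos (x : ℝ) : 0 < sinT ν x :=
  integral_pos_of_pos ν (integrable_sinT ν x) fun _ hα => mul_pos (Real.exp_pos _)
    (sin_pi_mul_pos hα)

/-- The lines Im z = ±π are the two sides of the cut of Φ along the negative axis. -/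
lemma symb_add_pi (x : ℝ) :
    symb ν (x + (Real.pi : ℝ) * Complex.I) = cosT ν x + sinT ν x * Complex.I := by
  unfold symb cosT sinT
  rw [← integral_complex_ofReal, ← integral_complex_ofReal, ← integral_mul_const,
    ← integral_add (integrable_cosT ν x).ofReal ((integrable_sinT ν x).ofReal.mul_const _)]
  refine integral_congr_ae (Eventually.of_forall fun α => ?_)
  simp only
  rw [show ((x : ℂ) + (Real.pi : ℝ) * Complex.I) * α =
    ((α * x : ℝ) : ℂ) + ((Real.pi * α : ℝ) : ℂ) * Complex.I by push_cast; ring, Complex.exp_add,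
    Complex.exp_mul_I]
  push_cast
  ring

lemma symb_sub_pi (x : ℝ) :
    symb ν (x + (-Real.pi : ℝ) * Complex.I) = cosT ν x - sinT ν x * Complex.I := by
  unfold symb cosT sinT
  rw [← integral_complex_ofReal, ← integral_complex_ofReal, ← integral_mul_const,
    ← integral_sub (integrable_cosT ν x).ofReal ((integrable_sinT ν x).ofReal.mul_const _)]
  refine integral_congr_ae (Eventually.of_forall fun α => ?_)
  simp only
  rw [show ((x : ℂ) + (-Real.pi : ℝ) * Complex.I) * α =
    ((α * x : ℝ) : ℂ) + -((Real.pi * α : ℝ) : ℂ) * Complex.I by push_cast; ring, Complex.exp_add,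
    Complex.exp_mul_I, Complex.cos_neg, Complex.sin_neg]
  push_cast
  ring

lemma continuous_sinT : Continuous (sinT ν) := by
  have h : sinT ν = fun x : ℝ => (symb ν (x + (Real.pi : ℝ) * Complex.I)).im := by
    funext x; rw [symb_add_pi]; simp
  rw [h]
  exact Complex.continuous_im.comp ((differentiable_symb ν).continuous.comp (by fun_prop))

lemma continuous_cosT : Continuous (cosT ν) := by
  have h : cosT ν = fun x : ℝ => (symb ν (x + (Real.pi : ℝ) * Complex.I)).re := by
    funext x; rw [symb_add_pi]; simp
  rw [h]
  exact Complex.continuous_re.comp ((differentiable_symb ν).continuous.comp (by fun_prop))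

lemma specDens_denom_pos (x : ℝ) : 0 < cosT ν x ^ 2 + sinT ν x ^ 2 := by
  have := sinT_pos ν x
  positivity

lemma specDens_pos (x : ℝ) : 0 < specDens ν x :=
  div_pos (sinT_pos ν x) (specDens_denom_pos ν x)

lemma continuous_specDens : Continuous (specDens ν) :=
  (continuous_sinT ν).div (((continuous_cosT ν).pow 2).add ((continuous_sinT ν).pow 2))
    fun x => (specDens_denom_pos ν x).ne'

/-- On the closed strip `|Im z| ≤ π` the symbol is bounded below by `sinT`. -/
lemma sinT_le_norm_symb (x : ℝ) {y : ℝ} (hy : |y| ≤ Real.pi) :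
    sinT ν x ≤ ‖symb ν (x + y * Complex.I)‖ := by
  -- Multiplying by e^(-iy/2) centres the phases αy at (α - 1/2)y, which lies within π/2 of 0; the
  -- real part of the integrand is then at least e^(αx) cos(π(α - 1/2)) = e^(αx) sin(πα).
  have hrot : Complex.exp (((-(y / 2) : ℝ) : ℂ) * Complex.I) * symb ν (x + y * Complex.I) =
      ∫ α : ℝ, Complex.exp (((α * x : ℝ) : ℂ) + (((α - 1 / 2) * y : ℝ) : ℂ) * Complex.I) ∂ν := by
    unfold symb
    rw [← integral_const_mul]
    refine integral_congr_ae (Eventually.of_forall fun α => ?_)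
    simp only
    rw [← Complex.exp_add]
    congr 1
    push_cast
    ring
  have hint : Integrable (fun α : ℝ => Complex.exp (((α * x : ℝ) : ℂ) +
      (((α - 1 / 2) * y : ℝ) : ℂ) * Complex.I)) ν := by
    rw [← integrable_norm_iff (by fun_prop)]
    simpa [Complex.norm_exp] using integrable_expT ν x
  calc sinT ν x ≤ ∫ α : ℝ, (Complex.exp (((α * x : ℝ) : ℂ) +
        (((α - 1 / 2) * y : ℝ) : ℂ) * Complex.I)).re ∂ν := by
        refine integral_mono_ae (integrable_sinT ν x) hint.re ?_
        filter_upwards [OrderMeasure.ae_mem (ν := ν)] with α hα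
        rw [Complex.exp_re]
        simp only [Complex.add_re, Complex.ofReal_re, Complex.mul_re, Complex.I_re, mul_zero,
          Complex.ofReal_im, Complex.I_im, mul_one, sub_self, add_zero, Complex.add_im,
          Complex.mul_im, zero_add]
        gcongr
        rw [show Real.pi * α = Real.pi / 2 - Real.pi * (1 / 2 - α) by ring,
          Real.sin_pi_div_two_sub, ← Real.cos_abs (Real.pi * (1 / 2 - α)),
          ← Real.cos_abs ((α - 1 / 2) * y)]
        have h12 : |1 / 2 - α| ≤ 1 / 2 := abs_le.2 ⟨by linarith [hα.2], by linarith [hα.1]⟩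
        refine Real.cos_le_cos_of_nonneg_of_le_pi (abs_nonneg _) ?_ ?_
        · rw [abs_mul, abs_of_pos Real.pi_pos]
          nlinarith [Real.pi_pos]
        · rw [abs_mul, abs_mul, abs_of_pos Real.pi_pos, abs_sub_comm, mul_comm]
          gcongr
    _ = (Complex.exp (((-(y / 2) : ℝ) : ℂ) * Complex.I) * symb ν (x + y * Complex.I)).re := by
        rw [hrot]
        exact integral_re hint
    _ ≤ ‖Complex.exp (((-(y / 2) : ℝ) : ℂ) * Complex.I) * symb ν (x + y * Complex.I)‖ :=
        Complex.re_le_norm _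
    _ = ‖symb ν (x + y * Complex.I)‖ := by
        rw [norm_mul, Complex.norm_exp_ofReal_mul_I, one_mul]

lemma symb_ne_zero {z : ℂ} (hz : |z.im| ≤ Real.pi) : symb ν z ≠ 0 := by
  rw [← norm_pos_iff]
  have := sinT_le_norm_symb ν z.re hz
  rw [Complex.re_add_im] at this
  exact (sinT_pos ν _).trans_le this

/-- From e^(αx) ≥ αx, `sinT` dominates x times a positive constant. Next, at -∞, the same argument
is applied with 1 - α in place of α. -/
lemma tendsto_sinT_atTop : Tendsto (sinT ν) atTop atTop := by
  have hi : Integrable (fun α => α * Real.sin (Real.pi * α)) ν :=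
    integrable_of_le_exp ν (by fun_prop) 0 fun α hα => by
      rw [abs_mul, abs_of_pos hα.1, mul_zero, Real.exp_zero]
      exact mul_le_one₀ hα.2.le (abs_nonneg _) (Real.abs_sin_le_one _)
  have hc : 0 < ∫ α, α * Real.sin (Real.pi * α) ∂ν :=
    integral_pos_of_pos ν hi fun α hα => mul_pos hα.1 (sin_pi_mul_pos hα)
  refine tendsto_atTop_mono (fun x => ?_) (tendsto_id.atTop_mul_const hc)
  rw [id, ← integral_const_mul]
  refine integral_mono_ae (hi.const_mul _) (integrable_sinT ν x) ?_
  filter_upwards [OrderMeasure.ae_mem (ν := ν)] with α hα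
  have h1 := sin_pi_mul_pos hα
  have h2 := Real.add_one_le_exp (α * x)
  nlinarith

lemma tendsto_exp_neg_mul_sinT_atBot :
    Tendsto (fun x => Real.exp (-x) * sinT ν x) atBot atTop := by
  have hi : Integrable (fun α => (1 - α) * Real.sin (Real.pi * α)) ν :=
    integrable_of_le_exp ν (by fun_prop) 0 fun α hα => by
      rw [abs_mul, abs_of_pos (by linarith [hα.2]), mul_zero, Real.exp_zero]
      exact mul_le_one₀ (by linarith [hα.1]) (abs_nonneg _) (Real.abs_sin_le_one _)
  have hc : 0 < ∫ α, (1 - α) * Real.sin (Real.pi * α) ∂ν :=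
    integral_pos_of_pos ν hi fun α hα => mul_pos (by linarith [hα.2]) (sin_pi_mul_pos hα)
  refine tendsto_atTop_mono (fun x => ?_) (tendsto_neg_atBot_atTop.atTop_mul_const hc)
  unfold sinT
  rw [← integral_const_mul, ← integral_const_mul]
  refine integral_mono_ae (hi.const_mul _) ((integrable_sinT ν x).const_mul _) ?_
  filter_upwards [OrderMeasure.ae_mem (ν := ν)] with α hα
  have h1 := sin_pi_mul_pos hα
  have h2 := Real.add_one_le_exp ((1 - α) * -x)
  rw [← mul_assoc (Real.exp (-x)), ← Real.exp_add, show -x + α * x = (1 - α) * -x by ring]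
  nlinarith

lemma sinT_le_expT (x : ℝ) : sinT ν x ≤ expT ν x := by
  refine integral_mono_ae (integrable_sinT ν x) (integrable_expT ν x)
    (Eventually.of_forall fun α => ?_)
  exact mul_le_of_le_one_right (Real.exp_pos _).le (Real.sin_le_one _)

lemma tendsto_expT_atTop : Tendsto (expT ν) atTop atTop :=
  tendsto_atTop_mono (sinT_le_expT ν) (tendsto_sinT_atTop ν)

end

/-! ### Contour integration: the Stieltjes representation of 1/Φ. -/

section

/-- `1 / Φ(e^z)` corrected by a multiple of `e^(-z/2)` so as to vanish at `z = c`. -/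
def numer (ν : Measure ℝ) (c : ℝ) (z : ℂ) : ℂ :=
  (symb ν z)⁻¹ - (symb ν c)⁻¹ * Complex.exp ((c - z) / 2)

lemma numer_self (ν : Measure ℝ) (c : ℝ) : numer ν c c = 0 := by simp [numer]

/-- The holomorphic integrand `numer z * e^z / (e^z - e^c)`, extended to `z = c`. -/
def contourFun (ν : Measure ℝ) (c : ℝ) (z : ℂ) : ℂ :=
  dslope (numer ν c) c z / dslope (fun z => Complex.exp z - Complex.exp c) c z * Complex.exp z

lemma contourFun_of_ne (ν : Measure ℝ) {c : ℝ} {z : ℂ} (h : z ≠ c) :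
    contourFun ν c z = numer ν c z * (Complex.exp z / (Complex.exp z - Complex.exp c)) := by
  unfold contourFun
  rw [dslope_of_ne _ h, dslope_of_ne _ h, slope_def_field, slope_def_field, numer_self]
  simp only [sub_self, sub_zero]
  rw [div_div_div_cancel_right₀ (sub_ne_zero.2 h)]
  ring

variable (ν : Measure ℝ) [OrderMeasure ν]

lemma differentiableAt_numer (c : ℝ) {z : ℂ} (hz : |z.im| ≤ Real.pi) :
    DifferentiableAt ℂ (numer ν c) z := by
  refine ((differentiable_symb ν z).inv (symb_ne_zero ν hz)).sub ?_
  fun_prop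

lemma cexp_ne_cexp_ofReal {c : ℝ} {z : ℂ} (hz : |z.im| ≤ Real.pi) (h : z ≠ c) :
    Complex.exp z - Complex.exp c ≠ 0 := by
  intro h0
  obtain ⟨n, hn⟩ := Complex.exp_eq_exp_iff_exists_int.1 (sub_eq_zero.1 h0)
  have him : z.im = n * (2 * Real.pi) := by
    rw [hn]; simp
  rw [him, abs_mul, abs_of_pos (by positivity : 0 < 2 * Real.pi)] at hz
  have hn0 : n = 0 := by
    by_contra hne
    have : (1 : ℝ) ≤ |(n : ℝ)| := by exact_mod_cast Int.one_le_abs hne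
    nlinarith [Real.pi_pos]
  exact h (by simpa [hn0] using hn)

lemma dslope_cexp_ne_zero {c : ℝ} {z : ℂ} (hz : |z.im| ≤ Real.pi) :
    dslope (fun z => Complex.exp z - Complex.exp c) c z ≠ 0 := by
  by_cases h : z = c
  · rw [h, dslope_same]
    simp
  · rw [dslope_of_ne _ h, slope_def_field]
    simp only [sub_self, sub_zero]
    exact div_ne_zero (cexp_ne_cexp_ofReal hz h) (sub_ne_zero.2 h)

/-- At z = c both divided differences are continuous, with values the derivatives, and the
denominator there is e^c ≠ 0. -/
lemma continuousAt_contourFun (c : ℝ) {z : ℂ} (hz : |z.im| ≤ Real.pi) :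
    ContinuousAt (contourFun ν c) z := by
  refine (ContinuousAt.div ?_ ?_ (dslope_cexp_ne_zero hz)).mul Complex.continuous_exp.continuousAt
  all_goals
    by_cases h : z = c
    · rw [h, continuousAt_dslope_same]
      first
        | exact differentiableAt_numer ν c (by simp [Real.pi_pos.le])
        | fun_prop
    · rw [continuousAt_dslope_of_ne h]
      first
        | exact (differentiableAt_numer ν c hz).continuousAt
        | fun_prop

lemma differentiableAt_contourFun (c : ℝ) {z : ℂ} (hz : |z.im| ≤ Real.pi) (h : z ≠ c) :
    DifferentiableAt ℂ (contourFun ν c) z := by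
  refine (DifferentiableAt.div ?_ ?_ (dslope_cexp_ne_zero hz)).mul Complex.differentiableAt_exp
  · rw [differentiableAt_dslope_of_ne h]
    exact differentiableAt_numer ν c hz
  · rw [differentiableAt_dslope_of_ne h]
    fun_prop

/-- Cauchy's theorem on [-R, R] × [-π, π]. At the exceptional point c continuity suffices, so no
residue is computed. -/
lemma contourFun_rect (c R : ℝ) :
    (∫ x : ℝ in (-R)..R, contourFun ν c (x + (-Real.pi : ℝ) * Complex.I)) -
      (∫ x : ℝ in (-R)..R, contourFun ν c (x + (Real.pi : ℝ) * Complex.I)) +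
      Complex.I • (∫ y : ℝ in (-Real.pi)..Real.pi, contourFun ν c ((R : ℝ) + y * Complex.I)) -
      Complex.I • (∫ y : ℝ in (-Real.pi)..Real.pi,
        contourFun ν c ((-R : ℝ) + y * Complex.I)) = 0 := by
  have hp := Real.pi_pos
  refine Complex.integral_boundary_rect_eq_zero_of_differentiable_on_off_countable
    (contourFun ν c) ⟨-R, -Real.pi⟩ ⟨R, Real.pi⟩ {(c : ℂ)} (countable_singleton _) ?_ ?_
  · intro z hz
    refine (continuousAt_contourFun ν c ?_).continuousWithinAt
    have := (Complex.mem_reProdIm.1 hz).2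
    rw [uIcc_of_le (by simp only; linarith)] at this
    exact abs_le.2 this
  · intro z hz
    refine differentiableAt_contourFun ν c ?_ hz.2
    have := (Complex.mem_reProdIm.1 hz.1).2
    simp only [min_eq_left (by linarith : -Real.pi ≤ Real.pi),
      max_eq_right (by linarith : -Real.pi ≤ Real.pi)] at this
    exact abs_le.2 ⟨this.1.le, this.2.le⟩

/-- The bound of `contourFun` on vertical segments. -/
def contourBound (c x : ℝ) : ℝ :=
  ((sinT ν x)⁻¹ + (expT ν c)⁻¹ * Real.exp ((c - x) / 2)) *
    (Real.exp x / |Real.exp x - Real.exp c|)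

/-- Uses `sinT_le_norm_symb` for 1/Φ and the reverse triangle inequality for e^z - e^c. -/
lemma norm_contourFun_le {c x : ℝ} (hx : x ≠ c) {y : ℝ} (hy : |y| ≤ Real.pi) :
    ‖contourFun ν c (x + y * Complex.I)‖ ≤ contourBound ν c x := by
  have hne : (x + y * Complex.I : ℂ) ≠ c := by
    intro h
    exact hx (by simpa using congrArg Complex.re h)
  rw [contourFun_of_ne ν hne, norm_mul, norm_div]
  have hnorm : ‖Complex.exp (x + y * Complex.I)‖ = Real.exp x := by simp [Complex.norm_exp]
  have hs := sinT_pos ν x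
  have habs : 0 < |Real.exp x - Real.exp c| := by
    rw [abs_pos, sub_ne_zero]
    exact fun h => hx (Real.exp_injective h)
  unfold contourBound
  have hden : |Real.exp x - Real.exp c| ≤
      ‖Complex.exp (x + y * Complex.I) - Complex.exp c‖ := by
    have h := abs_norm_sub_norm_le (Complex.exp (x + y * Complex.I)) (Complex.exp c)
    rwa [hnorm, Complex.norm_exp, Complex.ofReal_re] at h
  have hnum : ‖numer ν c (x + y * Complex.I)‖ ≤
      (sinT ν x)⁻¹ + (expT ν c)⁻¹ * Real.exp ((c - x) / 2) := by
    refine (norm_sub_le _ _).trans (add_le_add ?_ (le_of_eq ?_))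
    · rw [norm_inv]
      exact inv_anti₀ hs (sinT_le_norm_symb ν x hy)
    · rw [norm_mul, norm_inv, symb_ofReal, Complex.norm_real, Real.norm_of_nonneg (expT_pos ν c).le,
        Complex.norm_exp]
      simp
  rw [hnorm]
  have hF := (expT_pos ν c).le
  exact mul_le_mul hnum (div_le_div_of_nonneg_left (Real.exp_pos x).le habs hden)
    (by positivity) (by positivity)

lemma tendsto_contourBound_atTop (c : ℝ) : Tendsto (contourBound ν c) atTop (𝓝 0) := by
  have h1 : Tendsto (fun x => (sinT ν x)⁻¹ + (expT ν c)⁻¹ * Real.exp ((c - x) / 2)) atTop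
      (𝓝 (0 + (expT ν c)⁻¹ * 0)) := by
    refine (tendsto_inv_atTop_zero.comp (tendsto_sinT_atTop ν)).add (Tendsto.const_mul _ ?_)
    refine Real.tendsto_exp_atBot.comp ?_
    refine Tendsto.atBot_div_const two_pos ?_
    exact tendsto_atBot_add_const_left _ c tendsto_neg_atTop_atBot
  have h2 : Tendsto (fun x => Real.exp x / |Real.exp x - Real.exp c|) atTop (𝓝 (|1 - 0|)⁻¹) := by
    have h3 : Tendsto (fun x => (|1 - Real.exp (c - x)|)⁻¹) atTop (𝓝 (|1 - 0|)⁻¹) := by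
      refine Tendsto.inv₀ (Tendsto.abs (tendsto_const_nhds.sub ?_)) (by norm_num)
      exact Real.tendsto_exp_atBot.comp
        (tendsto_atBot_add_const_left _ c tendsto_neg_atTop_atBot)
    refine h3.congr fun x => ?_
    rw [show Real.exp x - Real.exp c = Real.exp x * (1 - Real.exp (c - x)) by
      rw [mul_sub, ← Real.exp_add]; simp, abs_mul, abs_of_pos (Real.exp_pos x),
      div_mul_cancel_left₀ (Real.exp_pos x).ne']
  have h4 := h1.mul h2
  rw [mul_zero, add_zero, zero_mul] at h4
  exact h4

/-- Here 1/`sinT` and e^((c-x)/2) need not be small; the factor e^x beats both, giving (e^(-x) sinT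
x)⁻¹ and e^((c+x)/2). -/
lemma tendsto_contourBound_atBot (c : ℝ) : Tendsto (contourBound ν c) atBot (𝓝 0) := by
  have h1 : Tendsto (fun x => (Real.exp (-x) * sinT ν x)⁻¹ +
      (expT ν c)⁻¹ * Real.exp ((c + x) / 2)) atBot (𝓝 (0 + (expT ν c)⁻¹ * 0)) := by
    refine (tendsto_inv_atTop_zero.comp (tendsto_exp_neg_mul_sinT_atBot ν)).add
      (Tendsto.const_mul _ ?_)
    refine Real.tendsto_exp_atBot.comp ?_
    refine Tendsto.atBot_div_const two_pos ?_
    exact tendsto_atBot_add_const_left _ c tendsto_id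
  have h2 : Tendsto (fun x => (|Real.exp x - Real.exp c|)⁻¹) atBot (𝓝 (|0 - Real.exp c|)⁻¹) := by
    refine Tendsto.inv₀ (Tendsto.abs (Real.tendsto_exp_atBot.sub_const _)) ?_
    simp [(Real.exp_pos c).ne']
  have h3 := h1.mul h2
  simp only [mul_zero, add_zero, zero_mul] at h3
  refine h3.congr fun x => ?_
  unfold contourBound
  rw [show (c + x) / 2 = (c - x) / 2 + x by ring, Real.exp_add, Real.exp_neg, mul_inv, inv_inv]
  ring

/-- The weight `e^x / (e^x + e^c)`. -/
def logisticWeight (c x : ℝ) : ℝ := Real.exp x / (Real.exp x + Real.exp c)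

lemma continuous_logisticWeight (c : ℝ) : Continuous (logisticWeight c) := by
  unfold logisticWeight
  exact Real.continuous_exp.div (by fun_prop) fun x => by positivity

/-- On both edges e^z = -e^x, so the quotient is the same real weight. The jump of 1/Φ is 1/(C - iS)
- 1/(C + iS) = 2i S/(C² + S²), and e^((c-z)/2) turns into ±i e^((c-x)/2). -/
lemma contourFun_jump (c x : ℝ) :
    contourFun ν c (x + (-Real.pi : ℝ) * Complex.I) -
      contourFun ν c (x + (Real.pi : ℝ) * Complex.I) =
    (2 * Complex.I) * (((specDens ν x - (expT ν c)⁻¹ * Real.exp ((c - x) / 2)) *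
      logisticWeight c x : ℝ) : ℂ) := by
  have hne : ∀ y : ℝ, y ≠ 0 → (x + y * Complex.I : ℂ) ≠ c := by
    intro y hy h
    exact hy (by simpa using congrArg Complex.im h)
  rw [contourFun_of_ne ν (hne _ (neg_ne_zero.2 Real.pi_ne_zero)),
    contourFun_of_ne ν (hne _ Real.pi_ne_zero)]
  have he1 : Complex.exp (x + (Real.pi : ℝ) * Complex.I) = -(Real.exp x : ℂ) := by
    rw [Complex.exp_add, Complex.exp_pi_mul_I]; simp
  have he2 : Complex.exp (x + (-Real.pi : ℝ) * Complex.I) = -(Real.exp x : ℂ) := by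
    rw [Complex.exp_add, Complex.ofReal_neg, neg_mul, Complex.exp_neg, Complex.exp_pi_mul_I]; simp
  have hw : -(Real.exp x : ℂ) / (-(Real.exp x : ℂ) - Complex.exp c) =
      (logisticWeight c x : ℂ) := by
    unfold logisticWeight
    rw [← Complex.ofReal_exp, ← neg_add', neg_div_neg_eq]
    push_cast
    rfl
  rw [he1, he2, hw, ← sub_mul]
  have hh1 : Complex.exp ((c - (x + (Real.pi : ℝ) * Complex.I)) / 2) =
      -(Complex.I * (Real.exp ((c - x) / 2) : ℂ)) := by
    rw [show ((c : ℂ) - (x + (Real.pi : ℝ) * Complex.I)) / 2 =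
      (((c - x) / 2 : ℝ) : ℂ) + -(Real.pi / 2 * Complex.I) by push_cast; ring, Complex.exp_add,
      Complex.exp_neg, Complex.exp_pi_div_two_mul_I, Complex.inv_I, Complex.ofReal_exp]
    ring
  have hh2 : Complex.exp ((c - (x + (-Real.pi : ℝ) * Complex.I)) / 2) =
      Complex.I * (Real.exp ((c - x) / 2) : ℂ) := by
    rw [show ((c : ℂ) - (x + (-Real.pi : ℝ) * Complex.I)) / 2 =
      (((c - x) / 2 : ℝ) : ℂ) + (Real.pi / 2 * Complex.I) by push_cast; ring, Complex.exp_add,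
      Complex.exp_pi_div_two_mul_I, Complex.ofReal_exp]
    ring
  unfold numer
  rw [hh1, hh2, symb_add_pi, symb_sub_pi, symb_ofReal]
  have hd1 : (cosT ν x + sinT ν x * Complex.I : ℂ) ≠ 0 := by
    intro h
    have := congrArg Complex.im h
    simp at this
    exact (sinT_pos ν x).ne' this
  have hd2 : (cosT ν x - sinT ν x * Complex.I : ℂ) ≠ 0 := by
    intro h
    have := congrArg Complex.im h
    simp at this
    exact (sinT_pos ν x).ne' this
  have hprod : (cosT ν x - sinT ν x * Complex.I : ℂ) * (cosT ν x + sinT ν x * Complex.I) =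
      ((cosT ν x ^ 2 + sinT ν x ^ 2 : ℝ) : ℂ) := by
    push_cast
    linear_combination -(sinT ν x : ℂ) ^ 2 * Complex.I_sq
  have hdiff : (cosT ν x - sinT ν x * Complex.I : ℂ)⁻¹ - (cosT ν x + sinT ν x * Complex.I)⁻¹ =
      2 * Complex.I * (specDens ν x : ℂ) := by
    rw [inv_sub_inv hd2 hd1, hprod]
    unfold specDens
    push_cast
    ring
  push_cast
  linear_combination (logisticWeight c x : ℂ) * hdiff

/-- By Cauchy's theorem the two horizontal sides differ by the vertical ones, whose length is 2π and
whose integrands tend to 0. -/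
lemma tendsto_jump_integral (c : ℝ) :
    Tendsto (fun R : ℝ => ∫ x in (-R)..R,
      (specDens ν x - (expT ν c)⁻¹ * Real.exp ((c - x) / 2)) * logisticWeight c x)
      atTop (𝓝 0) := by
  have hb : Tendsto (fun R => Real.pi * (contourBound ν c R + contourBound ν c (-R))) atTop
      (𝓝 0) := by
    have := ((tendsto_contourBound_atTop ν c).add
      ((tendsto_contourBound_atBot ν c).comp tendsto_neg_atTop_atBot)).const_mul Real.pi
    simpa using this
  refine squeeze_zero_norm' ?_ hb
  -- The vertical sides must avoid the abscissa c, where the bound is not valid.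
  filter_upwards [eventually_gt_atTop |c|] with R hR
  have hcR : R ≠ c := fun h => by rw [h] at hR; exact absurd (le_abs_self c) (not_le.2 hR)
  have hcR' : -R ≠ c := fun h => by
    rw [← h, abs_neg] at hR; exact absurd (le_abs_self R) (not_le.2 hR)
  have hp := Real.pi_pos
  have hcont : ∀ y : ℝ, |y| ≤ Real.pi →
      Continuous fun x : ℝ => contourFun ν c (x + y * Complex.I) := by
    intro y hy
    refine continuous_iff_continuousAt.2 fun x => ?_
    refine ContinuousAt.comp (g := contourFun ν c)
      (f := fun x : ℝ => (x + y * Complex.I : ℂ)) ?_ (by fun_prop)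
    exact continuousAt_contourFun ν c (by simpa using hy)
  have hrect := contourFun_rect ν c R
  rw [← intervalIntegral.integral_sub
    ((hcont _ (by rw [abs_neg, abs_of_pos hp])).intervalIntegrable _ _)
    ((hcont _ (by rw [abs_of_pos hp])).intervalIntegrable _ _)] at hrect
  simp_rw [contourFun_jump ν c] at hrect
  rw [intervalIntegral.integral_const_mul, intervalIntegral.integral_ofReal] at hrect
  have hv : ∀ x : ℝ, x ≠ c → ‖∫ y : ℝ in (-Real.pi)..Real.pi,
      contourFun ν c ((x : ℝ) + y * Complex.I)‖ ≤ contourBound ν c x * (2 * Real.pi) := by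
    intro x hx
    refine (intervalIntegral.norm_integral_le_of_norm_le_const (C := contourBound ν c x)
      fun y hy => ?_).trans_eq ?_
    · rw [uIoc_of_le (by linarith)] at hy
      exact norm_contourFun_le ν hx (abs_le.2 ⟨hy.1.le, hy.2⟩)
    · rw [sub_neg_eq_add, ← two_mul, abs_of_pos (by positivity)]
  have h1 := hv R hcR
  have h2 := hv (-R) hcR'
  set J := ∫ x in (-R)..R,
      (specDens ν x - (expT ν c)⁻¹ * Real.exp ((c - x) / 2)) * logisticWeight c x
  set A := ∫ y : ℝ in (-Real.pi)..Real.pi, contourFun ν c ((R : ℝ) + y * Complex.I)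
  set B := ∫ y : ℝ in (-Real.pi)..Real.pi, contourFun ν c ((-R : ℝ) + y * Complex.I)
  have hJ : (2 : ℂ) * (J : ℂ) = B - A := by
    have : Complex.I * (2 * (J : ℂ) + A - B) = 0 := by
      simp only [smul_eq_mul] at hrect
      linear_combination hrect
    have := (mul_eq_zero.1 this).resolve_left Complex.I_ne_zero
    linear_combination this
  have hn : 2 * ‖J‖ ≤ ‖B‖ + ‖A‖ := by
    calc 2 * ‖J‖ = ‖(2 : ℂ) * (J : ℂ)‖ := by simp
      _ ≤ _ := by rw [hJ]; exact norm_sub_le _ _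
  linarith

/-- The primitive 2 arctan(e^((x-c)/2)) increases from 0 to π; this is the source of the factor π in
the representation. -/
lemma tendsto_arctan_integral (c : ℝ) :
    Tendsto (fun R : ℝ => ∫ x in (-R)..R, Real.exp ((c - x) / 2) * logisticWeight c x)
      atTop (𝓝 Real.pi) := by
  have hder : ∀ x : ℝ, HasDerivAt (fun x => 2 * Real.arctan (Real.exp ((x - c) / 2)))
      (Real.exp ((c - x) / 2) * logisticWeight c x) x := by
    intro x
    have h := (((hasDerivAt_id x).sub_const c).div_const 2).exp.arctan.const_mul 2
    convert! h using 1
    unfold logisticWeight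
    set a := Real.exp ((x - c) / 2) with ha
    have ha0 : 0 < a := Real.exp_pos _
    have h1 : Real.exp ((c - x) / 2) = a⁻¹ := by rw [ha, ← Real.exp_neg]; congr 1; ring
    have h2 : Real.exp x = a ^ 2 * Real.exp c := by
      rw [ha, ← Real.exp_nat_mul, ← Real.exp_add]; congr 1; push_cast; ring
    simp only [id]
    rw [h1, h2, ← ha]
    have hc := Real.exp_pos c
    field_simp
    ring
  have hcont : Continuous fun x => Real.exp ((c - x) / 2) * logisticWeight c x :=
    (by fun_prop : Continuous fun x => Real.exp ((c - x) / 2)).mul (continuous_logisticWeight c)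
  have heq : ∀ R : ℝ, ∫ x in (-R)..R, Real.exp ((c - x) / 2) * logisticWeight c x =
      2 * Real.arctan (Real.exp ((R - c) / 2)) - 2 * Real.arctan (Real.exp ((-R - c) / 2)) :=
    fun R => intervalIntegral.integral_eq_sub_of_hasDerivAt (fun x _ => hder x)
      (hcont.intervalIntegrable _ _)
  simp_rw [heq]
  have e1 : Tendsto (fun R : ℝ => (R - c) / 2) atTop atTop :=
    (tendsto_atTop_add_const_right _ (-c) tendsto_id).atTop_div_const two_pos
  have e2 : Tendsto (fun R : ℝ => (-R - c) / 2) atTop atBot :=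
    (tendsto_atBot_add_const_right _ (-c) tendsto_neg_atTop_atBot).atBot_div_const two_pos
  have h1 : Tendsto (fun R : ℝ => Real.arctan (Real.exp ((R - c) / 2))) atTop
      (𝓝 (Real.pi / 2)) :=
    (Real.tendsto_arctan_atTop.mono_right nhdsWithin_le_nhds).comp
      (Real.tendsto_exp_atTop.comp e1)
  have h2 : Tendsto (fun R : ℝ => Real.arctan (Real.exp ((-R - c) / 2))) atTop
      (𝓝 (Real.arctan 0)) :=
    (Real.continuous_arctan.tendsto 0).comp (Real.tendsto_exp_atBot.comp e2)
  have := (h1.const_mul 2).sub (h2.const_mul 2)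
  simp only [Real.arctan_zero, mul_zero, sub_zero] at this
  convert this using 2
  ring

/-- Adding the two limits removes the auxiliary term. Positivity of the integrand upgrades the limit
over [-R, R] to a Lebesgue integral. -/
lemma lintegral_specDens_mul_logisticWeight (c : ℝ) :
    ∫⁻ x, ENNReal.ofReal (specDens ν x * logisticWeight c x) =
      ENNReal.ofReal (Real.pi / expT ν c) := by
  have hcont : Continuous fun x => specDens ν x * logisticWeight c x :=
    (continuous_specDens ν).mul (continuous_logisticWeight c)
  have hcont2 : Continuous fun x => Real.exp ((c - x) / 2) * logisticWeight c x :=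
    (by fun_prop : Continuous fun x => Real.exp ((c - x) / 2)).mul (continuous_logisticWeight c)
  have hnn : ∀ x, 0 ≤ specDens ν x * logisticWeight c x := fun x =>
    mul_nonneg (specDens_pos ν x).le (by unfold logisticWeight; positivity)
  have hlim : Tendsto (fun R : ℝ => ∫ x in (-R)..R, specDens ν x * logisticWeight c x) atTop
      (𝓝 (Real.pi / expT ν c)) := by
    have h := (tendsto_jump_integral ν c).add
      ((tendsto_arctan_integral c).const_mul (expT ν c)⁻¹)
    rw [zero_add, mul_comm, ← div_eq_mul_inv] at h
    refine h.congr fun R => ?_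
    rw [← intervalIntegral.integral_const_mul, ← intervalIntegral.integral_add]
    · refine intervalIntegral.integral_congr fun x _ => ?_
      ring
    · refine Continuous.intervalIntegrable ?_ _ _
      exact ((continuous_specDens ν).sub (by fun_prop)).mul (continuous_logisticWeight c)
    · exact (hcont2.const_mul _).intervalIntegrable _ _
  have hcover : AECover volume atTop (fun R : ℝ => Ioc (-R) R) :=
    aecover_Ioc tendsto_neg_atTop_atBot tendsto_id
  have h1 := hcover.lintegral_tendsto_of_countably_generated
    (hcont.measurable.ennreal_ofReal.aemeasurable)
  refine tendsto_nhds_unique h1 ?_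
  refine ((ENNReal.continuous_ofReal.tendsto _).comp hlim).congr' ?_
  filter_upwards [eventually_ge_atTop 0] with R hR
  rw [Function.comp_apply, intervalIntegral.integral_of_le (by linarith),
    ofReal_integral_eq_lintegral_ofReal (hcont.integrableOn_Ioc)
    (Eventually.of_forall hnn)]

/-- The Stieltjes representation of `1 / Φ`. -/
lemma lintegral_specDens_log (p : ℝ) (hp : 0 < p) :
    ∫⁻ r in Ioi (0 : ℝ), ENNReal.ofReal (specDens ν (Real.log r) / (r + p)) =
      ENNReal.ofReal (Real.pi / expT ν (Real.log p)) := by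
  -- Substitution r = e^x, with c = log p.
  have himg : Ioi (0 : ℝ) = Real.exp '' univ := by rw [image_univ, Real.range_exp]
  rw [himg, lintegral_image_eq_lintegral_abs_deriv_mul MeasurableSet.univ
    (fun x _ => (Real.hasDerivAt_exp x).hasDerivWithinAt) Real.exp_injective.injOn,
    setLIntegral_univ, ← lintegral_specDens_mul_logisticWeight]
  refine lintegral_congr fun x => ?_
  rw [← ENNReal.ofReal_mul (abs_nonneg _), abs_of_pos (Real.exp_pos x), Real.log_exp]
  unfold logisticWeight
  rw [Real.exp_log hp]
  congr 1
  ring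

end

/-! ### The kernels k and g, their Laplace transforms, and k * g = 1. -/

section

/-- The kernel `t^(-α) / Γ(1-α)` of the fractional derivative of order `α`. -/
def ordKer (α t : ℝ) : ℝ≥0∞ :=
  (Ioi (0 : ℝ)).indicator (fun t => ENNReal.ofReal ((Real.Gamma (1 - α))⁻¹ * t ^ (-α))) t

/-- The kernel `∫ t^(-α) / Γ(1-α) dν(α)` of the distributed order derivative. -/
def capKer (ν : Measure ℝ) (t : ℝ) : ℝ≥0∞ := ∫⁻ α, ordKer α t ∂ν

/-- The spectral density of the resolvent kernel. -/
def resDens (ν : Measure ℝ) (r : ℝ) : ℝ := specDens ν (Real.log r)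

/-- The resolvent kernel, as a nonnegative function on the half-line. -/
def resKer (ν : Measure ℝ) (t : ℝ) : ℝ≥0∞ :=
  (Ioi (0 : ℝ)).indicator (fun t => ∫⁻ r in Ioi (0 : ℝ),
    ENNReal.ofReal (1 / Real.pi * (Real.exp (-(r * t)) * resDens ν r))) t

/-- 1/Γ is entire, so the poles of Γ do not obstruct measurability in the order α. -/
lemma continuous_inv_Gamma : Continuous fun s : ℝ => (Real.Gamma s)⁻¹ := by
  have h : (fun s : ℝ => (Real.Gamma s)⁻¹) = fun s : ℝ => ((Complex.Gamma (s : ℂ))⁻¹).re := by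
    funext s
    rw [Complex.Gamma_ofReal, ← Complex.ofReal_inv, Complex.ofReal_re]
  rw [h]
  exact Complex.continuous_re.comp
    (Complex.differentiable_one_div_Gamma.continuous.comp Complex.continuous_ofReal)

lemma measurable_ordKer_uncurry : Measurable fun p : ℝ × ℝ => ordKer p.1 p.2 := by
  have hG : Measurable fun p : ℝ × ℝ => (Real.Gamma (1 - p.1))⁻¹ :=
    (continuous_inv_Gamma.comp (by fun_prop : Continuous fun p : ℝ × ℝ => 1 - p.1)).measurable
  have hp : Measurable fun p : ℝ × ℝ => p.2 ^ (-p.1) := by fun_prop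
  exact (hG.mul hp).ennreal_ofReal.indicator (measurable_snd measurableSet_Ioi)

lemma measurable_ordKer (α : ℝ) : Measurable (ordKer α) :=
  measurable_ordKer_uncurry.comp (measurable_const.prodMk measurable_id)

lemma measurable_capKer (ν : Measure ℝ) [SFinite ν] : Measurable (capKer ν) :=
  measurable_ordKer_uncurry.lintegral_prod_left'

lemma ordKer_of_nonpos (α : ℝ) {t : ℝ} (ht : t ≤ 0) : ordKer α t = 0 := by simp [ordKer, ht]

lemma capKer_of_nonpos (ν : Measure ℝ) {t : ℝ} (ht : t ≤ 0) : capKer ν t = 0 := by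
  simp [capKer, ordKer_of_nonpos _ ht]

lemma resKer_of_nonpos (ν : Measure ℝ) {t : ℝ} (ht : t ≤ 0) : resKer ν t = 0 := by
  simp [resKer, ht]

lemma heav_of_nonpos {t : ℝ} (ht : t ≤ 0) : heav t = 0 := by simp [heav, ht]

lemma lconv_of_nonpos {A B : ℝ → ℝ≥0∞} (hA : ∀ t ≤ 0, A t = 0) (hB : ∀ t ≤ 0, B t = 0)
    {t : ℝ} (ht : t ≤ 0) : (A ⋆ₗ B) t = 0 := by
  rw [lconv_eq_sub]
  refine (lintegral_congr fun s => ?_).trans lintegral_zero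
  rcases le_or_gt s 0 with hs | hs
  · simp [hB s hs]
  · simp [hA (t - s) (by linarith)]

lemma lap_ordKer {α p : ℝ} (hα : α < 1) (hp : 0 < p) :
    lap (ordKer α) p = ENNReal.ofReal (p ^ (α - 1)) := by
  have hG : 0 < Real.Gamma (1 - α) := Real.Gamma_pos_of_pos (by linarith)
  have h1 : ∀ t, ordKer α t * ENNReal.ofReal (Real.exp (-(p * t))) =
      (Ioi (0 : ℝ)).indicator (fun t => ENNReal.ofReal
        ((Real.Gamma (1 - α))⁻¹ * (t ^ ((1 - α) - 1) * Real.exp (-(p * t))))) t := by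
    intro t
    by_cases ht : t ∈ Ioi (0 : ℝ)
    · have ht' : (0 : ℝ) < t := ht
      simp only [ordKer, indicator_of_mem ht]
      rw [← ENNReal.ofReal_mul (by positivity)]
      congr 1
      rw [show (1 - α) - 1 = -α by ring, mul_assoc]
    · simp [ordKer, ht]
  have hi : IntegrableOn (fun t : ℝ => t ^ ((1 - α) - 1) * Real.exp (-(p * t))) (Ioi 0) := by
    have := integrableOn_rpow_mul_exp_neg_mul_rpow (s := (1 - α) - 1) (p := 1) (b := p)
      (by linarith) one_pos hp
    simpa [Real.rpow_one] using this
  unfold lap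
  simp_rw [h1]
  rw [lintegral_indicator measurableSet_Ioi, ← ofReal_integral_eq_lintegral_ofReal
    (hi.const_mul _), integral_const_mul, Real.integral_rpow_mul_exp_neg_mul_Ioi (by linarith) hp]
  · congr 1
    rw [one_div, Real.inv_rpow hp.le, ← Real.rpow_neg hp.le, neg_sub, mul_comm, mul_assoc,
      mul_inv_cancel₀ hG.ne', mul_one]
  · filter_upwards [ae_restrict_mem measurableSet_Ioi] with t ht
    have : (0 : ℝ) < t := ht
    simp only [Pi.zero_apply]
    positivity

variable (ν : Measure ℝ) [OrderMeasure ν]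

lemma lap_capKer {p : ℝ} (hp : 0 < p) :
    lap (capKer ν) p = ENNReal.ofReal (expT ν (Real.log p) / p) := by
  have hm : Measurable fun q : ℝ × ℝ =>
      ordKer q.2 q.1 * ENNReal.ofReal (Real.exp (-(p * q.1))) :=
    (measurable_ordKer_uncurry.comp measurable_swap).mul (by fun_prop)
  calc lap (capKer ν) p
      = ∫⁻ t, ∫⁻ α, ordKer α t * ENNReal.ofReal (Real.exp (-(p * t))) ∂ν := by
        refine lintegral_congr fun t => ?_
        rw [lintegral_mul_const]
        · rfl
        · exact measurable_ordKer_uncurry.comp (measurable_id.prodMk measurable_const)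
    _ = ∫⁻ α, lap (ordKer α) p ∂ν := lintegral_lintegral_swap hm.aemeasurable
    _ = ∫⁻ α, ENNReal.ofReal (Real.exp (α * Real.log p) * p⁻¹) ∂ν := by
        refine lintegral_congr_ae ?_
        filter_upwards [OrderMeasure.ae_mem (ν := ν)] with α hα
        rw [lap_ordKer hα.2 hp, Real.rpow_sub hp, Real.rpow_one, Real.rpow_def_of_pos hp,
          mul_comm α, div_eq_mul_inv]
    _ = ENNReal.ofReal (expT ν (Real.log p) / p) := by
        rw [← ofReal_integral_eq_lintegral_ofReal ((integrable_expT ν _).mul_const _)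
          (Eventually.of_forall fun α => by positivity), integral_mul_const, div_eq_mul_inv]
        rfl

lemma measurable_resDens : Measurable (resDens ν) :=
  (continuous_specDens ν).measurable.comp Real.measurable_log

lemma measurable_resKer : Measurable (resKer ν) := by
  have h := measurable_resDens ν
  refine Measurable.indicator ?_ measurableSet_Ioi
  refine Measurable.lintegral_prod_right' (f := fun q : ℝ × ℝ => ENNReal.ofReal
    (1 / Real.pi * (Real.exp (-(q.2 * q.1)) * resDens ν q.2))) ?_
  fun_prop

/-- Integrating e^(-(r+p)t) in t first leaves the Stieltjes integral of the spectral density. -/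
lemma lap_resKer {p : ℝ} (hp : 0 < p) :
    lap (resKer ν) p = ENNReal.ofReal (1 / expT ν (Real.log p)) := by
  have hsm := measurable_resDens ν
  have hpi := Real.pi_pos
  have hnn : ∀ r, 0 ≤ resDens ν r := fun r => (specDens_pos ν _).le
  have h1 : ∀ t, resKer ν t * ENNReal.ofReal (Real.exp (-(p * t))) =
      (Ioi (0 : ℝ)).indicator (fun t => ∫⁻ r in Ioi (0 : ℝ), ENNReal.ofReal
        (1 / Real.pi * resDens ν r) * ENNReal.ofReal (Real.exp (-(r + p) * t))) t := by
    intro t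
    by_cases ht : t ∈ Ioi (0 : ℝ)
    · simp only [resKer, indicator_of_mem ht]
      rw [← lintegral_mul_const _ (by fun_prop)]
      refine lintegral_congr fun r => ?_
      have := hnn r
      rw [← ENNReal.ofReal_mul (by positivity), ← ENNReal.ofReal_mul (by positivity)]
      congr 1
      rw [show -(r + p) * t = -(r * t) + -(p * t) by ring, Real.exp_add]
      ring
    · simp [resKer, ht]
  unfold lap
  simp_rw [h1]
  have hm : Measurable fun q : ℝ × ℝ => ENNReal.ofReal (1 / Real.pi * resDens ν q.2) *
      ENNReal.ofReal (Real.exp (-(q.2 + p) * q.1)) := by fun_prop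
  rw [lintegral_indicator measurableSet_Ioi, lintegral_lintegral_swap hm.aemeasurable]
  calc ∫⁻ r in Ioi (0 : ℝ), ∫⁻ t in Ioi (0 : ℝ), ENNReal.ofReal
        (1 / Real.pi * resDens ν r) * ENNReal.ofReal (Real.exp (-(r + p) * t))
      = ∫⁻ r in Ioi (0 : ℝ), ENNReal.ofReal (1 / Real.pi) *
          ENNReal.ofReal (resDens ν r / (r + p)) := by
        refine setLIntegral_congr_fun measurableSet_Ioi fun r hr => ?_
        have hr0 : (0 : ℝ) < r := hr
        rw [lintegral_const_mul _ (by fun_prop), ← ofReal_integral_eq_lintegral_ofReal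
          (integrableOn_exp_mul_Ioi (by linarith) 0)
          (Eventually.of_forall fun t => (Real.exp_pos _).le),
          integral_exp_mul_Ioi (by linarith), ENNReal.ofReal_mul (by positivity), mul_assoc,
          ← ENNReal.ofReal_mul (hnn r)]
        congr 2
        rw [mul_zero, Real.exp_zero, neg_div_neg_eq, mul_one_div]
    _ = _ := by
        rw [lintegral_const_mul _ (by fun_prop)]
        unfold resDens
        rw [lintegral_specDens_log ν p hp,
          ← ENNReal.ofReal_mul (by positivity)]
        congr 1
        field_simp

/-- The Sonine identity `k * g = 1`. -/
lemma capKer_lconv_resKer : (capKer ν ⋆ₗ resKer ν) =ᵐ[volume] heav := by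
  have hK := measurable_capKer ν
  have hG := measurable_resKer ν
  -- The transforms multiply to Φ(p)/p · 1/Φ(p) = 1/p.
  refine ae_eq_heav_of_lap (measurable_lconvolution _ hK hG)
    (fun t ht => lconv_of_nonpos (fun _ => capKer_of_nonpos ν) (fun _ => resKer_of_nonpos ν) ht)
    fun p hp => ?_
  have he := expT_pos ν (Real.log p)
  rw [lap_lconvolution hK hG, lap_capKer ν hp, lap_resKer ν hp,
    ← ENNReal.ofReal_mul (by positivity)]
  congr 1
  field_simp

/-- The Laplace transform of the resolvent kernel is arbitrarily small at large arguments. -/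
lemma exists_lap_resKer_le (c : ℝ) : ∃ σ : ℝ, 0 < σ ∧ ∃ q : ℝ, 0 < q ∧ c * q ≤ 1 / 2 ∧
    lap (resKer ν) σ = ENNReal.ofReal q := by
  -- Take σ = e^x with Φ(σ) ≥ 2c and q = 1/Φ(σ).
  obtain ⟨x, hx⟩ := ((tendsto_expT_atTop ν).eventually_ge_atTop (2 * c)).exists
  have he := expT_pos ν x
  refine ⟨Real.exp x, Real.exp_pos x, 1 / expT ν x, by positivity, ?_, ?_⟩
  · rw [mul_one_div, div_le_div_iff₀ he two_pos]
    linarith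
  · rw [lap_resKer ν (Real.exp_pos x), Real.log_exp]

end

/-! ### Exponentially weighted estimates for convolutions. -/

section

lemma lconv_heav_eq (A : ℝ → ℝ≥0∞) (x : ℝ) : (A ⋆ₗ heav) x = ∫⁻ s in Iio x, A s := by
  rw [lconvolution_def, ← lintegral_indicator measurableSet_Iio]
  refine lintegral_congr fun s => ?_
  by_cases hs : s < x
  · simp [heav, hs]
  · simp [heav, hs]

/-- Chernoff's trick: 1 ≤ e^(σ(x-s)) for s < x. -/
lemma lconv_heav_le {A : ℝ → ℝ≥0∞} (hA : Measurable A) {σ : ℝ} (hσ : 0 ≤ σ) (x : ℝ) :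
    (A ⋆ₗ heav) x ≤ ENNReal.ofReal (Real.exp (σ * x)) * lap A σ := by
  rw [lconv_heav_eq]
  unfold lap
  rw [← lintegral_const_mul _ (by fun_prop)]
  refine (setLIntegral_mono' measurableSet_Iio fun s hs => ?_).trans (setLIntegral_le_lintegral _ _)
  rw [mul_left_comm, ← ENNReal.ofReal_mul (Real.exp_pos _).le, ← Real.exp_add]
  refine le_mul_of_one_le_right zero_le ?_
  rw [← ENNReal.ofReal_one]
  refine ENNReal.ofReal_le_ofReal (Real.one_le_exp ?_)
  have : s < x := hs
  nlinarith

lemma lconv_le_of_le {A F : ℝ → ℝ≥0∞} (hF : Measurable F) {σ : ℝ} {C : ℝ≥0∞}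
    (h : ∀ x, A x ≤ ENNReal.ofReal (Real.exp (σ * x)) * C) (t : ℝ) :
    (A ⋆ₗ F) t ≤ ENNReal.ofReal (Real.exp (σ * t)) * (C * lap F σ) := by
  rw [lconv_eq_sub]
  unfold lap
  rw [← lintegral_const_mul _ (by fun_prop), ← lintegral_const_mul _ (by fun_prop)]
  refine lintegral_mono fun s => ?_
  calc A (t - s) * F s ≤ ENNReal.ofReal (Real.exp (σ * (t - s))) * C * F s := by gcongr; exact h _
    _ = _ := by
      rw [show σ * (t - s) = σ * t + -(σ * s) by ring, Real.exp_add,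
        ENNReal.ofReal_mul (Real.exp_pos _).le]
      ring

/-- The Heaviside factor makes the bound hold at every t; without it, finite transforms give
finiteness only almost everywhere, as in `ae_lconv_lt_top`. -/
lemma lconv_heav_lconv_ne_top {A F : ℝ → ℝ≥0∞} (hA : Measurable A) (hF : Measurable F) {σ : ℝ}
    (hσ : 0 ≤ σ) (hlA : lap A σ ≠ ⊤) (hlF : lap F σ ≠ ⊤) (t : ℝ) :
    ((A ⋆ₗ heav) ⋆ₗ F) t ≠ ⊤ :=
  ne_top_of_le_ne_top (ENNReal.mul_ne_top ENNReal.ofReal_ne_top (ENNReal.mul_ne_top hlA hlF))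
    (lconv_le_of_le hF (lconv_heav_le hA hσ) t)

lemma ae_lconv_lt_top {A F : ℝ → ℝ≥0∞} (hA : Measurable A) (hF : Measurable F) {σ : ℝ}
    (hlA : lap A σ ≠ ⊤) (hlF : lap F σ ≠ ⊤) : ∀ᵐ t, (A ⋆ₗ F) t < ⊤ := by
  have hm := measurable_lconvolution volume hA hF
  have h : lap (A ⋆ₗ F) σ ≠ ⊤ := by
    rw [lap_lconvolution hA hF]
    exact ENNReal.mul_ne_top hlA hlF
  filter_upwards [ae_lt_top (by fun_prop) h] with t ht
  by_contra hcon
  rw [not_lt_top_iff.1 hcon, ENNReal.top_mul (by simp [Real.exp_pos])] at ht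
  exact lt_irrefl _ ht

lemma cconv_of_nonpos {A : ℝ → ℝ≥0∞} {f : ℝ → ℂ} (hA : ∀ t ≤ 0, A t = 0)
    (hf : ∀ t ≤ 0, f t = 0) {t : ℝ} (ht : t ≤ 0) : cconv A f t = 0 := by
  unfold cconv
  refine (integral_congr_ae (g := fun _ => (0 : ℂ)) (Eventually.of_forall fun s => ?_)).trans
    (integral_zero _ _)
  rcases le_or_gt s 0 with hs | hs
  · simp [hf s hs]
  · simp [hA (t - s) (by linarith)]

lemma cconv_eq_intervalIntegral {A : ℝ → ℝ≥0∞} {f : ℝ → ℂ} (hA : ∀ t ≤ 0, A t = 0)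
    (hf : ∀ t ≤ 0, f t = 0) {t : ℝ} (ht : 0 ≤ t) :
    cconv A f t = ∫ s in (0 : ℝ)..t, (A (t - s)).toReal • f s := by
  rw [intervalIntegral.integral_of_le ht, ← integral_indicator measurableSet_Ioc]
  refine integral_congr_ae (Eventually.of_forall fun s => ?_)
  by_cases hs : s ∈ Ioc 0 t
  · simp [hs]
  · rw [indicator_of_notMem hs]
    rcases le_or_gt s 0 with h0 | h0
    · simp [hf s h0]
    · have : t < s := by
        by_contra hcon
        exact hs ⟨h0, not_lt.1 hcon⟩
      simp [hA (t - s) (by linarith)]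

lemma cconv_heav {f : ℝ → ℂ} (hf : ∀ t ≤ 0, f t = 0) (t : ℝ) :
    cconv heav f t = ∫ s in (0 : ℝ)..t, f s := by
  rcases le_or_gt 0 t with ht | ht
  · rw [cconv_eq_intervalIntegral (fun _ => heav_of_nonpos) hf ht,
      intervalIntegral.integral_of_le ht, intervalIntegral.integral_of_le ht,
      integral_Ioc_eq_integral_Ioo,
      integral_Ioc_eq_integral_Ioo]
    refine setIntegral_congr_fun measurableSet_Ioo fun s hs => ?_
    simp [heav, hs.2]
  · rw [cconv_of_nonpos (fun _ => heav_of_nonpos) hf ht.le, intervalIntegral.integral_of_ge ht.le,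
      setIntegral_congr_fun measurableSet_Ioc (g := fun _ => (0 : ℂ)) fun s hs => hf s hs.2]
    simp

/-- Functions on the half-line with absolutely convergent Laplace transform at `σ`. -/
structure LapBdd (σ : ℝ) (f : ℝ → ℂ) : Prop where
  meas : StronglyMeasurable f
  zero : ∀ t ≤ 0, f t = 0
  pos : 0 < σ
  fin : lap (fun t => ‖f t‖ₑ) σ ≠ ⊤

lemma LapBdd.measurable_enorm {σ : ℝ} {f : ℝ → ℂ} (hf : LapBdd σ f) :
    Measurable fun t => ‖f t‖ₑ := hf.meas.measurable.enorm

lemma LapBdd.integrableOn_Iio {σ : ℝ} {f : ℝ → ℂ} (hf : LapBdd σ f) (t : ℝ) :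
    IntegrableOn f (Iio t) := by
  refine ⟨hf.meas.aestronglyMeasurable, ?_⟩
  have h := lconv_heav_le hf.measurable_enorm hf.pos.le t
  rw [lconv_heav_eq] at h
  exact h.trans_lt (ENNReal.mul_lt_top ENNReal.ofReal_lt_top hf.fin.lt_top)

lemma LapBdd.locallyIntegrable {σ : ℝ} {f : ℝ → ℂ} (hf : LapBdd σ f) : LocallyIntegrable f :=
  fun x => ⟨Iio (x + 1), Iio_mem_nhds (by linarith), hf.integrableOn_Iio _⟩

lemma LapBdd.intervalIntegrable {σ : ℝ} {f : ℝ → ℂ} (hf : LapBdd σ f) (a b : ℝ) :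
    IntervalIntegrable f volume a b := by
  rw [intervalIntegrable_iff]
  exact (hf.locallyIntegrable.integrableOn_isCompact isCompact_uIcc).mono_set uIoc_subset_uIcc

lemma LapBdd.cconv {σ : ℝ} {f : ℝ → ℂ} (hf : LapBdd σ f) {A : ℝ → ℝ≥0∞} (hA : Measurable A)
    (hA0 : ∀ t ≤ 0, A t = 0) (hlA : lap A σ ≠ ⊤) : LapBdd σ (cconv A f) := by
  refine ⟨?_, fun t ht => cconv_of_nonpos hA0 hf.zero ht, hf.pos, ?_⟩
  · have hm := hf.meas.measurable
    exact StronglyMeasurable.integral_prod_right'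
      (f := fun p : ℝ × ℝ => (A (p.1 - p.2)).toReal • f p.2)
      (by fun_prop : Measurable _).stronglyMeasurable
  · refine ne_top_of_le_ne_top ?_ (lintegral_mono fun t =>
      mul_le_mul_left (enorm_cconv_le A f t) _)
    change lap _ σ ≠ ⊤
    rw [lap_lconvolution hA hf.measurable_enorm]
    exact ENNReal.mul_ne_top hlA hf.fin

/-- `I^1 (A * f) = (A * 1) * f`. -/
lemma LapBdd.integral_cconv {σ : ℝ} {f : ℝ → ℂ} (hf : LapBdd σ f) {A : ℝ → ℝ≥0∞}
    (hA : Measurable A) (hA0 : ∀ t ≤ 0, A t = 0) (hlA : lap A σ ≠ ⊤) (t : ℝ) :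
    ∫ s in (0 : ℝ)..t, DistOrder.cconv A f s = DistOrder.cconv (A ⋆ₗ heav) f t := by
  rw [← cconv_heav (hf.cconv hA hA0 hlA).zero, cconv_assoc measurable_heav hA
    hf.meas.aestronglyMeasurable, lconvolution_comm]
  rw [lconvolution_comm (f := heav)]
  exact lconv_heav_lconv_ne_top hA hf.measurable_enorm hf.pos.le hlA hf.fin t

/-- `A * (I^1 f) = (A * 1) * f`. -/
lemma LapBdd.cconv_integral {σ : ℝ} {f : ℝ → ℂ} (hf : LapBdd σ f) {A : ℝ → ℝ≥0∞}
    (hA : Measurable A) (hlA : lap A σ ≠ ⊤) (t : ℝ) :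
    DistOrder.cconv A (fun s => ∫ r in (0 : ℝ)..s, f r) t = DistOrder.cconv (A ⋆ₗ heav) f t := by
  rw [← cconv_assoc hA measurable_heav hf.meas.aestronglyMeasurable
    (lconv_heav_lconv_ne_top hA hf.measurable_enorm hf.pos.le hlA hf.fin t)]
  congr 1
  funext s
  rw [cconv_heav hf.zero]

lemma lap_ordKer_ne_top {α σ : ℝ} (hα : α < 1) (hσ : 0 < σ) : lap (ordKer α) σ ≠ ⊤ := by
  rw [lap_ordKer hα hσ]; exact ENNReal.ofReal_ne_top

/-! ### Fractional and distributed order derivatives of absolutely continuous functions. -/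

/-- The fractional integral of `w - w 0` for absolutely continuous `w`. -/
lemma rlIntegral_eq_cconv {σ : ℝ} {f : ℝ → ℂ} (hf : LapBdd σ f) {α : ℝ} (hα : α < 1)
    {T : ℝ} {w : ℝ → ℂ} (hw : ∀ t ∈ Icc 0 T, w t - w 0 = ∫ s in (0 : ℝ)..t, f s)
    {t : ℝ} (ht : t ∈ Icc 0 T) :
    rlIntegral (1 - α) (fun s => w s - w 0) t = cconv (ordKer α ⋆ₗ heav) f t := by
  -- Since w - w(0) = 1 * f, the fractional integral of order 1-α is the kernel of order α convolved
  -- with 1 * f.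
  rw [← hf.cconv_integral (measurable_ordKer α) (lap_ordKer_ne_top hα hf.pos),
    cconv_eq_intervalIntegral (fun _ => ordKer_of_nonpos α) _ ht.1]
  · unfold rlIntegral
    rw [← intervalIntegral.integral_smul, intervalIntegral.integral_of_le ht.1,
      intervalIntegral.integral_of_le ht.1, integral_Ioc_eq_integral_Ioo,
      integral_Ioc_eq_integral_Ioo]
    refine setIntegral_congr_fun measurableSet_Ioo fun s hs => ?_
    simp only
    rw [← hw s ⟨hs.1.le, hs.2.le.trans ht.2⟩, smul_smul]
    congr 1
    have hts : t - s ∈ Ioi (0 : ℝ) := sub_pos.2 hs.2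
    have hG := Real.Gamma_pos_of_pos (show 0 < 1 - α by linarith)
    rw [ordKer, indicator_of_mem hts, ENNReal.toReal_ofReal
      (mul_nonneg (by positivity) (Real.rpow_nonneg (le_of_lt hts) _))]
    congr 2
    ring
  · intro s hs
    rw [← cconv_heav hf.zero]
    exact cconv_of_nonpos (fun _ => heav_of_nonpos) hf.zero hs

/-- (A * 1) * f is a primitive of the locally integrable A * f, so Lebesgue's differentiation
theorem applies. -/
lemma ae_hasDerivAt_cconv_heav {σ : ℝ} {f : ℝ → ℂ} (hf : LapBdd σ f) {A : ℝ → ℝ≥0∞}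
    (hA : Measurable A) (hA0 : ∀ t ≤ 0, A t = 0) (hlA : lap A σ ≠ ⊤) :
    ∀ᵐ t, HasDerivAt (cconv (A ⋆ₗ heav) f) (cconv A f t) t := by
  have h := hf.cconv hA hA0 hlA
  filter_upwards [LocallyIntegrable.ae_hasDerivAt_integral h.locallyIntegrable] with t ht
  have h1 := ht 0
  simp_rw [hf.integral_cconv hA hA0 hlA] at h1
  exact h1

lemma continuous_cconv_heav {σ : ℝ} {f : ℝ → ℂ} (hf : LapBdd σ f) {A : ℝ → ℝ≥0∞}
    (hA : Measurable A) (hA0 : ∀ t ≤ 0, A t = 0) (hlA : lap A σ ≠ ⊤) :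
    Continuous (cconv (A ⋆ₗ heav) f) := by
  have h := intervalIntegral.continuous_primitive (hf.cconv hA hA0 hlA).intervalIntegrable 0
  simp_rw [hf.integral_cconv hA hA0 hlA] at h
  exact h

/-- For continuous functions, rational difference quotients suffice. -/
lemma hasDerivAt_of_tendsto_rat {F : ℝ → ℂ} (hF : Continuous F) {t : ℝ} {d : ℂ}
    (h : Tendsto (fun q : ℚ => (q : ℝ)⁻¹ • (F (t + q) - F t))
      (comap ((↑) : ℚ → ℝ) (𝓝[≠] 0)) (𝓝 d)) : HasDerivAt F d t := by
  rw [hasDerivAt_iff_tendsto_slope_zero, Metric.tendsto_nhdsWithin_nhds]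
  intro ε hε
  have h1 := h.eventually (Metric.closedBall_mem_nhds d (half_pos hε))
  rw [eventually_comap] at h1
  rw [eventually_nhdsWithin_iff, Metric.eventually_nhds_iff] at h1
  obtain ⟨δ, hδ, h2⟩ := h1
  refine ⟨δ, hδ, fun x hx hxδ => ?_⟩
  have hcont : ContinuousAt (fun y : ℝ => y⁻¹ • (F (t + y) - F t)) x :=
    (continuousAt_inv₀ hx).smul (by fun_prop)
  -- The quotient is continuous in the increment away from 0, so a closed bound on nearby rational
  -- increments passes to x.
  have hcl : x ∈ closure (({0}ᶜ ∩ Metric.ball 0 δ) ∩ range ((↑) : ℚ → ℝ)) := by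
    have ho : IsOpen (({0}ᶜ : Set ℝ) ∩ Metric.ball 0 δ) :=
      isOpen_compl_singleton.inter Metric.isOpen_ball
    exact (Rat.denseRange_cast (𝕜 := ℝ)).open_subset_closure_inter ho ⟨hx, hxδ⟩
  have hmem := hcont.continuousWithinAt.mem_closure hcl (t := Metric.closedBall d (ε / 2)) (by
    rintro y ⟨⟨hy0, hyδ⟩, q, rfl⟩
    exact h2 hyδ hy0 q rfl)
  rw [Metric.isClosed_closedBall.closure_eq, Metric.mem_closedBall] at hmem
  linarith

lemma tendsto_rat_of_hasDerivAt {F : ℝ → ℂ} {t : ℝ} {d : ℂ} (h : HasDerivAt F d t) :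
    Tendsto (fun q : ℚ => (q : ℝ)⁻¹ • (F (t + q) - F t))
      (comap ((↑) : ℚ → ℝ) (𝓝[≠] 0)) (𝓝 d) := by
  rw [hasDerivAt_iff_tendsto_slope_zero] at h
  exact h.comp tendsto_comap

/-- For almost every time, the derivative exists for almost every order. -/
lemma ae_ae_hasDerivAt {σ : ℝ} {f : ℝ → ℂ} (hf : LapBdd σ f) :
    ∀ᵐ t, ∀ᵐ α ∂(volume.restrict (Ioo (0 : ℝ) 1)),
      HasDerivAt (cconv (ordKer α ⋆ₗ heav) f) (cconv (ordKer α) f t) t := by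
  have hfm := hf.meas.measurable
  have hk := measurable_ordKer_uncurry
  have hh := measurable_heav
  have hD : Measurable fun p : ℝ × ℝ => cconv (ordKer p.1) f p.2 := by
    have hu : Measurable fun x : (ℝ × ℝ) × ℝ => ordKer x.1.1 (x.1.2 - x.2) :=
      hk.comp (by fun_prop : Measurable fun x : (ℝ × ℝ) × ℝ => (x.1.1, x.1.2 - x.2))
    exact (StronglyMeasurable.integral_prod_right'
      (f := fun x : (ℝ × ℝ) × ℝ => (ordKer x.1.1 (x.1.2 - x.2)).toReal • f x.2)
      (by fun_prop : Measurable _).stronglyMeasurable).measurable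
  have hkh : Measurable fun p : ℝ × ℝ => (ordKer p.1 ⋆ₗ heav) p.2 := by
    have hu : Measurable fun x : (ℝ × ℝ) × ℝ => ordKer x.1.1 x.2 :=
      hk.comp (by fun_prop : Measurable fun x : (ℝ × ℝ) × ℝ => (x.1.1, x.2))
    exact Measurable.lintegral_prod_right'
      (f := fun x : (ℝ × ℝ) × ℝ => ordKer x.1.1 x.2 * heav (-x.2 + x.1.2)) (by fun_prop)
  have hF : Measurable fun p : ℝ × ℝ => cconv (ordKer p.1 ⋆ₗ heav) f p.2 := by
    have hu : Measurable fun x : (ℝ × ℝ) × ℝ => (ordKer x.1.1 ⋆ₗ heav) (x.1.2 - x.2) :=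
      hkh.comp (by fun_prop : Measurable fun x : (ℝ × ℝ) × ℝ => (x.1.1, x.1.2 - x.2))
    exact (StronglyMeasurable.integral_prod_right'
      (f := fun x : (ℝ × ℝ) × ℝ => ((ordKer x.1.1 ⋆ₗ heav) (x.1.2 - x.2)).toReal • f x.2)
      (by fun_prop : Measurable _).stronglyMeasurable).measurable
  -- Only countably many increments occur, so the set of good pairs (α, t) is measurable. This is
  -- what permits exchanging "for almost every α, almost every t" with the reverse order.
  have hset : MeasurableSet {p : ℝ × ℝ | Tendsto (fun q : ℚ => (q : ℝ)⁻¹ •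
      (cconv (ordKer p.1 ⋆ₗ heav) f (p.2 + q) - cconv (ordKer p.1 ⋆ₗ heav) f p.2))
      (comap ((↑) : ℚ → ℝ) (𝓝[≠] 0)) (𝓝 (cconv (ordKer p.1) f p.2))} := by
    refine measurableSet_tendsto_fun (fun q => ?_) hD
    have h1 : Measurable fun p : ℝ × ℝ => cconv (ordKer p.1 ⋆ₗ heav) f (p.2 + q) :=
      hF.comp (by fun_prop : Measurable fun p : ℝ × ℝ => (p.1, p.2 + (q : ℝ)))
    exact (h1.sub hF).const_smul (q : ℝ)⁻¹
  have hae : ∀ᵐ α ∂(volume.restrict (Ioo (0 : ℝ) 1)), ∀ᵐ t : ℝ,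
      Tendsto (fun q : ℚ => (q : ℝ)⁻¹ •
        (cconv (ordKer α ⋆ₗ heav) f (t + q) - cconv (ordKer α ⋆ₗ heav) f t))
        (comap ((↑) : ℚ → ℝ) (𝓝[≠] 0)) (𝓝 (cconv (ordKer α) f t)) := by
    filter_upwards [ae_restrict_mem measurableSet_Ioo] with α hα
    filter_upwards [ae_hasDerivAt_cconv_heav hf (measurable_ordKer α)
      (fun _ => ordKer_of_nonpos α) (lap_ordKer_ne_top hα.2 hf.pos)] with t ht
    exact tendsto_rat_of_hasDerivAt ht
  filter_upwards [(Measure.ae_ae_comm hset).1 hae] with t ht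
  filter_upwards [ht, ae_restrict_mem measurableSet_Ioo] with α h1 hα
  exact hasDerivAt_of_tendsto_rat (continuous_cconv_heav hf (measurable_ordKer α)
    (fun _ => ordKer_of_nonpos α) (lap_ordKer_ne_top hα.2 hf.pos)) h1

/-- The measure `μ(α) dα` on `(0,1)`. -/
def orderMeasure (μ : ℝ → ℝ) : Measure ℝ :=
  (volume.restrict (Ioo (0 : ℝ) 1)).withDensity fun α => ENNReal.ofReal (μ α)

section

variable {μ : ℝ → ℝ}

lemma orderMeasure_isOrderMeasure (hμ_int : IntegrableOn μ (Ioo (0 : ℝ) 1))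
    (hμ_nonneg : ∀ᵐ α ∂(volume.restrict (Ioo (0 : ℝ) 1)), 0 ≤ μ α)
    (hμ_pos : 0 < ∫ α in Ioo (0 : ℝ) 1, μ α) :
    OrderMeasure (orderMeasure μ) := by
  have h1 : IsFiniteMeasure (orderMeasure μ) := isFiniteMeasure_withDensity_ofReal hμ_int.2
  refine { h1 with ae_mem := ?_, ne_zero := ?_ }
  · exact (withDensity_absolutelyContinuous _ _).ae_le (ae_restrict_mem measurableSet_Ioo)
  · intro h
    have h2 : orderMeasure μ univ = 0 := by rw [h]; simp
    rw [orderMeasure, withDensity_apply _ MeasurableSet.univ, setLIntegral_univ,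
      ← ofReal_integral_eq_lintegral_ofReal hμ_int hμ_nonneg, ENNReal.ofReal_eq_zero] at h2
    linarith

lemma integral_orderMeasure {E : Type*} [NormedAddCommGroup E] [NormedSpace ℝ E]
    (hμ_int : IntegrableOn μ (Ioo (0 : ℝ) 1))
    (hμ_nonneg : ∀ᵐ α ∂(volume.restrict (Ioo (0 : ℝ) 1)), 0 ≤ μ α) (φ : ℝ → E) :
    ∫ α, φ α ∂(orderMeasure μ) = ∫ α in Ioo (0 : ℝ) 1, μ α • φ α := by
  rw [orderMeasure, integral_withDensity_eq_integral_toReal_smul₀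
    hμ_int.1.aemeasurable.ennreal_ofReal (Eventually.of_forall fun _ => ENNReal.ofReal_lt_top)]
  refine integral_congr_ae ?_
  filter_upwards [hμ_nonneg] with α hα
  rw [ENNReal.toReal_ofReal hα]

lemma integrable_orderMeasure_iff {E : Type*} [NormedAddCommGroup E] [NormedSpace ℝ E]
    (hμ_int : IntegrableOn μ (Ioo (0 : ℝ) 1))
    (hμ_nonneg : ∀ᵐ α ∂(volume.restrict (Ioo (0 : ℝ) 1)), 0 ≤ μ α) (φ : ℝ → E) :
    Integrable φ (orderMeasure μ) ↔ IntegrableOn (fun α => μ α • φ α) (Ioo (0 : ℝ) 1) := by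
  rw [orderMeasure, integrable_withDensity_iff_integrable_smul₀'
    hμ_int.1.aemeasurable.ennreal_ofReal (Eventually.of_forall fun _ => ENNReal.ofReal_lt_top)]
  refine integrable_congr ?_
  filter_upwards [hμ_nonneg] with α hα
  rw [ENNReal.toReal_ofReal hα]

end

/-- Superposition over the orders. -/
lemma integral_cconv_ordKer (ν : Measure ℝ) [SFinite ν] {f : ℝ → ℂ} (hf : StronglyMeasurable f)
    {t : ℝ} (h : (capKer ν ⋆ₗ fun s => ‖f s‖ₑ) t ≠ ⊤) :
    Integrable (fun α => cconv (ordKer α) f t) ν ∧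
      ∫ α, cconv (ordKer α) f t ∂ν = cconv (capKer ν) f t := by
  have hfm := hf.measurable
  have hu : Measurable fun x : ℝ × ℝ => ordKer x.1 (t - x.2) :=
    measurable_ordKer_uncurry.comp (by fun_prop : Measurable fun x : ℝ × ℝ => (x.1, t - x.2))
  have hm : Measurable fun x : ℝ × ℝ => (ordKer x.1 (t - x.2)).toReal • f x.2 := by fun_prop
  have hu1 : ∀ s, Measurable fun α => ordKer α (t - s) := fun s =>
    measurable_ordKer_uncurry.comp (by fun_prop : Measurable fun α : ℝ => (α, t - s))
  rw [lconv_eq_sub] at h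
  have hint : Integrable (fun x : ℝ × ℝ => (ordKer x.1 (t - x.2)).toReal • f x.2)
      (ν.prod volume) := by
    refine ⟨hm.aestronglyMeasurable, ?_⟩
    refine lt_of_le_of_lt (b := ∫⁻ x : ℝ × ℝ, ordKer x.1 (t - x.2) * ‖f x.2‖ₑ ∂(ν.prod volume))
      (lintegral_mono fun x => ?_) ?_
    · rw [enorm_smul]
      gcongr
      rw [Real.enorm_of_nonneg ENNReal.toReal_nonneg]
      exact ENNReal.ofReal_toReal_le
    · rw [lintegral_prod_symm _ (by fun_prop)]
      refine lt_of_eq_of_lt (lintegral_congr fun s => ?_) h.lt_top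
      simp only
      rw [lintegral_mul_const _ (hu1 s)]
      rfl
  refine ⟨hint.integral_prod_left, ?_⟩
  have hfin : ∀ᵐ s, capKer ν (t - s) * ‖f s‖ₑ < ⊤ := by
    refine ae_lt_top ?_ h
    exact ((measurable_capKer ν).comp (measurable_const.sub measurable_id)).mul hfm.enorm
  calc ∫ α, cconv (ordKer α) f t ∂ν = ∫ s, ∫ α, (ordKer α (t - s)).toReal • f s ∂ν :=
        integral_integral_swap hint
    _ = cconv (capKer ν) f t := by
        refine integral_congr_ae ?_
        filter_upwards [hfin] with s hs
        rw [integral_smul_const]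
        by_cases hz : f s = 0
        · simp [hz]
        congr 1
        have hne : capKer ν (t - s) ≠ ⊤ := by
          intro htop
          rw [htop, ENNReal.top_mul (by simpa using hz)] at hs
          exact lt_irrefl _ hs
        exact integral_toReal (hu1 s).aemeasurable (ae_lt_top (hu1 s) hne)

/-- The distributed order derivative of an absolutely continuous function. -/
lemma ae_distCaputo_eq {μ : ℝ → ℝ} [OrderMeasure (orderMeasure μ)]
    (hμ_int : IntegrableOn μ (Ioo (0 : ℝ) 1))
    (hμ_nonneg : ∀ᵐ α ∂(volume.restrict (Ioo (0 : ℝ) 1)), 0 ≤ μ α)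
    {σ : ℝ} {f : ℝ → ℂ} (hf : LapBdd σ f)
    {T : ℝ} {w : ℝ → ℂ} (hw : ∀ t ∈ Icc 0 T, w t - w 0 = ∫ s in (0 : ℝ)..t, f s) :
    ∀ᵐ t ∂(volume.restrict (Ioo (0 : ℝ) T)),
      DistCaputoDefinedAt μ w t ∧ distCaputo μ w t = cconv (capKer (orderMeasure μ)) f t := by
  have hl : lap (capKer (orderMeasure μ)) σ ≠ ⊤ := by
    rw [lap_capKer _ hf.pos]; exact ENNReal.ofReal_ne_top
  -- Finiteness of k * |f| at t is what makes the derivative integrable over the orders.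
  have hfin := ae_lconv_lt_top (measurable_capKer (orderMeasure μ)) hf.measurable_enorm hl hf.fin
  filter_upwards [ae_restrict_of_ae (ae_ae_hasDerivAt hf), ae_restrict_of_ae hfin,
    ae_restrict_mem measurableSet_Ioo] with t h1 h2 ht
  obtain ⟨hint, heq⟩ := integral_cconv_ordKer (orderMeasure μ) hf.meas h2.ne
  have hder : ∀ᵐ α ∂(volume.restrict (Ioo (0 : ℝ) 1)),
      HasDerivAt (rlIntegral (1 - α) (fun s => w s - w 0)) (cconv (ordKer α) f t) t := by
    filter_upwards [h1, ae_restrict_mem measurableSet_Ioo] with α hα hα1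
    refine hα.congr_of_eventuallyEq ?_
    -- The integral formula for w is known only on [0, T], a neighbourhood of the interior point t.
    filter_upwards [Icc_mem_nhds ht.1 ht.2] with s hs
    exact rlIntegral_eq_cconv hf hα1.2 hw hs
  have hcap : (fun α => μ α • caputoDeriv α w t) =ᵐ[volume.restrict (Ioo (0 : ℝ) 1)]
      fun α => μ α • cconv (ordKer α) f t := by
    filter_upwards [hder] with α hα
    rw [← hα.deriv]
    rfl
  refine ⟨⟨hder.mono fun α hα => hα.differentiableAt, ?_⟩, ?_⟩
  · exact ((integrable_orderMeasure_iff hμ_int hμ_nonneg _).1 hint).congr hcap.symm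
  · rw [← heq, integral_orderMeasure hμ_int hμ_nonneg]
    exact integral_congr_ae hcap

end

/-! ### Termwise convolution of series, and the iterates of g. -/

section

section Series

variable {σ : ℝ} {a : ℕ → ℝ → ℂ}

lemma LapBdd.tsum (ha : ∀ k, LapBdd σ (a k))
    (hsum : ∑' k, lap (fun t => ‖a k t‖ₑ) σ ≠ ⊤) : LapBdd σ fun t => ∑' k, a k t := by
  refine ⟨(Measurable.tsum fun k => (ha k).meas.measurable).stronglyMeasurable,
    fun t ht => ?_, (ha 0).pos, ne_top_of_le_ne_top hsum ?_⟩
  · simp [fun k => (ha k).zero t ht]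
  · have hm := fun k => (ha k).measurable_enorm
    unfold lap
    rw [← lintegral_tsum fun k => by fun_prop]
    refine lintegral_mono fun t => ?_
    rw [ENNReal.tsum_mul_right]
    gcongr
    -- Valid also where the series diverges, its sum then being 0 by default.
    exact enorm_tsum_le_tsum_enorm

lemma ae_tsum_lconv_lt_top (ha : ∀ k, LapBdd σ (a k))
    (hsum : ∑' k, lap (fun t => ‖a k t‖ₑ) σ ≠ ⊤)
    {A : ℝ → ℝ≥0∞} (hA : Measurable A) (hlA : lap A σ ≠ ⊤) :
    ∀ᵐ t, ∑' k, (A ⋆ₗ fun s => ‖a k s‖ₑ) t < ⊤ := by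
  have hm := fun k => measurable_lconvolution volume hA (ha k).measurable_enorm
  have h : ∫⁻ t, (∑' k, (A ⋆ₗ fun s => ‖a k s‖ₑ) t) * ENNReal.ofReal (Real.exp (-(σ * t))) ≠ ⊤ := by
    simp_rw [← ENNReal.tsum_mul_right]
    rw [lintegral_tsum fun k => by fun_prop]
    have h1 : ∀ k, lap (A ⋆ₗ fun s => ‖a k s‖ₑ) σ = lap A σ * lap (fun s => ‖a k s‖ₑ) σ :=
      fun k => lap_lconvolution hA (ha k).measurable_enorm σ
    change ∑' k, lap (A ⋆ₗ fun s => ‖a k s‖ₑ) σ ≠ ⊤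
    simp_rw [h1]
    rw [ENNReal.tsum_mul_left]
    exact ENNReal.mul_ne_top hlA hsum
  filter_upwards [ae_lt_top (by fun_prop) h] with t ht
  by_contra hcon
  rw [not_lt_top_iff.1 hcon, ENNReal.top_mul (by simp [Real.exp_pos])] at ht
  exact lt_irrefl _ ht

lemma tsum_heav_lconv_ne_top (ha : ∀ k, LapBdd σ (a k))
    (hsum : ∑' k, lap (fun t => ‖a k t‖ₑ) σ ≠ ⊤) (t : ℝ) : ∑' k, (heav ⋆ₗ fun s => ‖a k s‖ₑ) t ≠ ⊤ := by
  refine ne_top_of_le_ne_top (b := ∑' k, ENNReal.ofReal (Real.exp (σ * t)) *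
    lap (fun s => ‖a k s‖ₑ) σ) ?_ (ENNReal.tsum_le_tsum fun k => ?_)
  · rw [ENNReal.tsum_mul_left]
    exact ENNReal.mul_ne_top ENNReal.ofReal_ne_top hsum
  · rw [lconvolution_comm]
    exact lconv_heav_le (ha k).measurable_enorm (ha k).pos.le t

lemma ae_tsum_enorm_ne_top (ha : ∀ k, LapBdd σ (a k))
    (hsum : ∑' k, lap (fun t => ‖a k t‖ₑ) σ ≠ ⊤) : ∀ᵐ t, ∑' k, ‖a k t‖ₑ ≠ ⊤ := by
  have hm := fun k => (ha k).measurable_enorm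
  have h : ∫⁻ t, (∑' k, ‖a k t‖ₑ) * ENNReal.ofReal (Real.exp (-(σ * t))) ≠ ⊤ := by
    simp_rw [← ENNReal.tsum_mul_right]
    rw [lintegral_tsum fun k => by fun_prop]
    exact hsum
  filter_upwards [ae_lt_top (by fun_prop) h] with t ht
  intro hcon
  rw [hcon, ENNReal.top_mul (by simp [Real.exp_pos])] at ht
  exact lt_irrefl _ ht

lemma cconv_tsum (ha : ∀ k, LapBdd σ (a k)) {A : ℝ → ℝ≥0∞} (hA : Measurable A) {t : ℝ}
    (h : ∑' k, (A ⋆ₗ fun s => ‖a k s‖ₑ) t ≠ ⊤) :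
    cconv A (fun s => ∑' k, a k s) t = ∑' k, cconv A (a k) t := by
  have hm := fun k => (ha k).meas.measurable
  unfold cconv
  rw [← integral_tsum]
  · refine integral_congr_ae (Eventually.of_forall fun s => ?_)
    exact (tsum_const_smul'' _).symm
  · exact fun k => (by fun_prop : Measurable fun s => (A (t - s)).toReal • a k s).aestronglyMeasurable
  · refine ne_top_of_le_ne_top h (ENNReal.tsum_le_tsum fun k => ?_)
    rw [lconv_eq_sub]
    refine lintegral_mono fun s => ?_
    rw [enorm_smul]
    gcongr
    rw [Real.enorm_of_nonneg ENNReal.toReal_nonneg]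
    exact ENNReal.ofReal_toReal_le

lemma integral_tsum_of_lapBdd (ha : ∀ k, LapBdd σ (a k))
    (hsum : ∑' k, lap (fun t => ‖a k t‖ₑ) σ ≠ ⊤) (t : ℝ) :
    ∫ s in (0 : ℝ)..t, ∑' k, a k s = ∑' k, ∫ s in (0 : ℝ)..t, a k s := by
  rw [← cconv_heav (LapBdd.tsum ha hsum).zero,
    cconv_tsum ha measurable_heav (tsum_heav_lconv_ne_top ha hsum t)]
  exact tsum_congr fun k => cconv_heav (ha k).zero t

end Series

/-- `g^[k] * g`. -/
def resPow (ν : Measure ℝ) : ℕ → ℝ → ℝ≥0∞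
  | 0 => resKer ν
  | k + 1 => resKer ν ⋆ₗ resPow ν k

/-- `g^[k] * 1`. -/
def resIter (ν : Measure ℝ) : ℕ → ℝ → ℝ≥0∞
  | 0 => heav
  | k + 1 => resPow ν k ⋆ₗ heav

lemma resPow_of_nonpos (ν : Measure ℝ) (k : ℕ) : ∀ t ≤ 0, resPow ν k t = 0 := by
  induction k with
  | zero => exact fun t ht => resKer_of_nonpos ν ht
  | succ k ih => exact fun t ht => lconv_of_nonpos (fun _ => resKer_of_nonpos ν) ih ht

/-- The `k`-th term of the derivative of the series. -/
def derivTerm (ν : Measure ℝ) (lam : ℂ) (k : ℕ) (t : ℝ) : ℂ := (-lam) ^ (k + 1) * ((resPow ν k t).toReal : ℂ)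

lemma enorm_derivTerm_le (ν : Measure ℝ) (lam : ℂ) (k : ℕ) (t : ℝ) :
    ‖derivTerm ν lam k t‖ₑ ≤ ‖lam‖ₑ ^ (k + 1) * resPow ν k t := by
  rw [derivTerm, enorm_mul, enorm_pow, enorm_neg]
  gcongr
  rw [← ofReal_norm, Complex.norm_real, Real.norm_of_nonneg ENNReal.toReal_nonneg]
  exact ENNReal.ofReal_toReal_le

/-- A pair `σ`, `q` with `‖lam‖ q ≤ 1 / 2`, where `q` is the Laplace transform of the kernel
at `σ`. -/
structure SmallAt (ν : Measure ℝ) (lam : ℂ) (σ q : ℝ) : Prop where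
  pos : 0 < σ
  q_pos : 0 < q
  small : ‖lam‖ * q ≤ 1 / 2
  lap_eq : lap (resKer ν) σ = ENNReal.ofReal q

lemma SmallAt.enorm_mul_le {ν : Measure ℝ} {lam : ℂ} {σ q : ℝ} (h : SmallAt ν lam σ q) :
    ‖lam‖ₑ * lap (resKer ν) σ ≤ 2⁻¹ := by
  rw [h.lap_eq, ← ofReal_norm, ← ENNReal.ofReal_mul (norm_nonneg _)]
  refine (ENNReal.ofReal_le_ofReal h.small).trans_eq ?_
  rw [one_div, ENNReal.ofReal_inv_of_pos two_pos]
  simp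

lemma resIter_of_nonpos (ν : Measure ℝ) (k : ℕ) : ∀ t ≤ 0, resIter ν k t = 0 := by
  cases k with
  | zero => exact fun t ht => heav_of_nonpos ht
  | succ k => exact fun t ht => lconv_of_nonpos (resPow_of_nonpos ν k) (fun _ => heav_of_nonpos) ht

variable (ν : Measure ℝ) [OrderMeasure ν]

lemma measurable_resPow (k : ℕ) : Measurable (resPow ν k) := by
  induction k with
  | zero => exact measurable_resKer ν
  | succ k ih => exact measurable_lconvolution _ (measurable_resKer ν) ih

lemma measurable_resIter (k : ℕ) : Measurable (resIter ν k) := by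
  cases k with
  | zero => exact measurable_heav
  | succ k => exact measurable_lconvolution _ (measurable_resPow ν k) measurable_heav

lemma lap_resPow (k : ℕ) (σ : ℝ) : lap (resPow ν k) σ = lap (resKer ν) σ ^ (k + 1) := by
  induction k with
  | zero => simp [resPow]
  | succ k ih =>
    rw [resPow, lap_lconvolution (measurable_resKer ν) (measurable_resPow ν k), ih, ← pow_succ']

lemma resKer_lconv_resIter (k : ℕ) : resKer ν ⋆ₗ resIter ν k = resIter ν (k + 1) := by
  cases k with
  | zero => rfl
  | succ k => exact lconvolution_assoc (measurable_resKer ν) (measurable_resPow ν k) measurable_heav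

/-- The identity k * g = 1 removes one factor g. This step lowers the index when the derivative is
applied to the series. -/
lemma capKer_lconv_resPow (k : ℕ) : (capKer ν ⋆ₗ resPow ν k) =ᵐ[volume] resIter ν k := by
  cases k with
  | zero => exact capKer_lconv_resKer ν
  | succ k =>
    refine Eventually.of_forall fun t => ?_
    rw [resPow, lconvolution_assoc (measurable_capKer ν) (measurable_resKer ν)
      (measurable_resPow ν k), resIter, lconvolution_comm (f := resPow ν k), lconvolution_def,
      lconvolution_def]
    refine lintegral_congr_ae ?_
    filter_upwards [capKer_lconv_resKer ν] with s hs
    rw [hs]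

/-- The transform of a convolution power is a power of the transform, so the iterates are bounded
geometrically at each fixed t. -/
lemma resIter_le {σ : ℝ} (hσ : 0 ≤ σ) (k : ℕ) (t : ℝ) :
    resIter ν k t ≤ ENNReal.ofReal (Real.exp (σ * t)) * lap (resKer ν) σ ^ k := by
  cases k with
  | zero =>
    rw [pow_zero, mul_one]
    rcases le_or_gt t 0 with ht | ht
    · rw [resIter, heav_of_nonpos ht]; exact zero_le
    · have : resIter ν 0 t = 1 := by simp [resIter, heav, ht]
      rw [this, ← ENNReal.ofReal_one]
      exact ENNReal.ofReal_le_ofReal (Real.one_le_exp (by positivity))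
  | succ k =>
    rw [← lap_resPow]
    exact lconv_heav_le (measurable_resPow ν k) hσ t

lemma resIter_ne_top (k : ℕ) (t : ℝ) : resIter ν k t ≠ ⊤ := by
  refine ne_top_of_le_ne_top ?_ (resIter_le ν zero_le_one k t)
  rw [lap_resKer ν one_pos]
  exact ENNReal.mul_ne_top ENNReal.ofReal_ne_top (ENNReal.pow_ne_top ENNReal.ofReal_ne_top)

/-- Nothing is asked of `g` at t ≤ 0: the convolution integrals are taken over open intervals, where
t - s > 0. -/
lemma iterConv_eq_resIter {g : ℝ → ℝ} (hg : ∀ t, 0 < t → g t = (resKer ν t).toReal) (k : ℕ)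
    {t : ℝ} (ht : 0 < t) : iterConv g k (fun _ => 1) t = (resIter ν k t).toReal := by
  induction k generalizing t with
  | zero => simp [iterConv, resIter, heav, ht]
  | succ k ih =>
    have hm : Measurable fun s => resKer ν (t - s) * resIter ν k s :=
      ((measurable_resKer ν).comp (by fun_prop)).mul (measurable_resIter ν k)
    have hne := resIter_ne_top ν (k + 1) t
    rw [← resKer_lconv_resIter, lconv_eq_sub] at hne ⊢
    rw [iterConv, Function.iterate_succ_apply', conv, ← integral_toReal hm.aemeasurable
      (ae_lt_top hm hne), intervalIntegral.integral_of_le ht.le, integral_Ioc_eq_integral_Ioo,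
      ← integral_indicator measurableSet_Ioo]
    refine integral_congr_ae (Eventually.of_forall fun s => ?_)
    by_cases hs : s ∈ Ioo 0 t
    · simp only [indicator_of_mem hs]
      rw [hg _ (sub_pos.2 hs.2), ENNReal.toReal_mul]
      congr 1
      exact ih hs.1
    · simp only [indicator_of_notMem hs]
      rcases le_or_gt s 0 with h0 | h0
      · simp [resIter_of_nonpos ν k s h0]
      · have : t ≤ s := by
          by_contra hcon
          exact hs ⟨h0, not_le.1 hcon⟩
        simp [resKer_of_nonpos ν (show t - s ≤ 0 by linarith)]

/-- At t = 0 the series has zeroth term 1 while `heav` vanishes, so this point is kept apart from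
the identification with `resIter`. -/
lemma iterConv_succ_zero (g : ℝ → ℝ) (k : ℕ) : iterConv g (k + 1) (fun _ => 1) 0 = 0 := by
  rw [iterConv, Function.iterate_succ_apply', conv, intervalIntegral.integral_same]

lemma cconv_derivTerm {A : ℝ → ℝ≥0∞} (hA : Measurable A) (lam : ℂ) (k : ℕ) {t : ℝ}
    (h : (A ⋆ₗ resPow ν k) t ≠ ⊤) :
    cconv A (derivTerm ν lam k) t = (-lam) ^ (k + 1) * (((A ⋆ₗ resPow ν k) t).toReal : ℂ) := by
  have hP := measurable_resPow ν k
  have hm : Measurable fun s => A (t - s) * resPow ν k s := by fun_prop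
  rw [lconv_eq_sub] at h ⊢
  rw [← integral_toReal hm.aemeasurable (ae_lt_top hm h), ← integral_complex_ofReal,
    ← integral_const_mul]
  refine integral_congr_ae (Eventually.of_forall fun s => ?_)
  simp only [derivTerm, ENNReal.toReal_mul, Complex.real_smul]
  push_cast
  ring

lemma lap_derivTerm_le (lam : ℂ) (k : ℕ) (σ : ℝ) :
    lap (fun t => ‖derivTerm ν lam k t‖ₑ) σ ≤ (‖lam‖ₑ * lap (resKer ν) σ) ^ (k + 1) := by
  have hP := measurable_resPow ν k
  rw [mul_pow, ← lap_resPow]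
  unfold lap
  rw [← lintegral_const_mul _ (by fun_prop)]
  refine lintegral_mono fun t => ?_
  rw [← mul_assoc]
  gcongr
  exact enorm_derivTerm_le ν lam k t

lemma lapBdd_derivTerm {σ : ℝ} (hσ : 0 < σ) (lam : ℂ) (k : ℕ) :
    LapBdd σ (derivTerm ν lam k) := by
  have hP := measurable_resPow ν k
  refine ⟨?_, fun t ht => ?_, hσ, ne_top_of_le_ne_top ?_ (lap_derivTerm_le ν lam k σ)⟩
  · unfold derivTerm
    exact (by fun_prop : Measurable _).stronglyMeasurable
  · simp [derivTerm, resPow_of_nonpos ν k t ht]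
  · rw [lap_resKer ν hσ]
    exact ENNReal.pow_ne_top (ENNReal.mul_ne_top (by simp) ENNReal.ofReal_ne_top)

variable {ν}

/-- Domination by the sum of 2^(-(k+1)); the choice of σ enters the convergence of the derivative
series here. -/
lemma SmallAt.tsum_lap_ne_top {lam : ℂ} {σ q : ℝ} (h : SmallAt ν lam σ q) :
    ∑' k, lap (fun t => ‖derivTerm ν lam k t‖ₑ) σ ≠ ⊤ := by
  refine ne_top_of_le_ne_top (b := ∑' k : ℕ, (2⁻¹ : ℝ≥0∞) ^ (k + 1)) ?_
    (ENNReal.tsum_le_tsum fun k => ?_)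
  · rw [ENNReal.tsum_geometric_add_one]
    exact ENNReal.mul_ne_top (by simp) (by simp)
  · refine (lap_derivTerm_le ν lam k σ).trans ?_
    gcongr
    exact h.enorm_mul_le

lemma resIter_toReal_le {σ q : ℝ} (hσ : 0 ≤ σ) (hq : 0 ≤ q)
    (h : lap (resKer ν) σ = ENNReal.ofReal q) (k : ℕ) (t : ℝ) :
    (resIter ν k t).toReal ≤ Real.exp (σ * t) * q ^ k := by
  have h1 := resIter_le ν hσ k t
  rw [h, ← ENNReal.ofReal_pow hq, ← ENNReal.ofReal_mul (Real.exp_pos _).le] at h1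
  exact ENNReal.toReal_le_of_le_ofReal (by positivity) h1

/-- The derivative of the series. -/
def derivSum (ν : Measure ℝ) (lam : ℂ) (t : ℝ) : ℂ := ∑' k, derivTerm ν lam k t

lemma SmallAt.lapBdd_derivSum {lam : ℂ} {σ q : ℝ} (h : SmallAt ν lam σ q) :
    LapBdd σ (derivSum ν lam) :=
  LapBdd.tsum (fun k => lapBdd_derivTerm ν h.pos lam k) h.tsum_lap_ne_top

/-- The index shifts because the zeroth term of the series is constant and has no derivative to
list. -/
lemma integral_derivTerm (lam : ℂ) (k : ℕ) (t : ℝ) :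
    ∫ s in (0 : ℝ)..t, derivTerm ν lam k s =
      (-lam) ^ (k + 1) * ((resIter ν (k + 1) t).toReal : ℂ) := by
  have he : heav ⋆ₗ resPow ν k = resIter ν (k + 1) := lconvolution_comm
  rw [← cconv_heav (lapBdd_derivTerm ν one_pos lam k).zero, cconv_derivTerm ν measurable_heav, he]
  rw [he]
  exact resIter_ne_top ν (k + 1) t

end

/-! ### Absolute continuity, weak derivatives and the W^{1,1} norm. -/

section

/-- Serves to pass, in both directions, between a complex function and its real and imaginary parts.
-/
lemma absolutelyContinuousOnInterval_of_dist_le {X Y Z : Type*} [PseudoMetricSpace X]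
    [PseudoMetricSpace Y] [PseudoMetricSpace Z] {F₁ : ℝ → X} {F₂ : ℝ → Y} {w : ℝ → Z} {a b : ℝ}
    (h₁ : AbsolutelyContinuousOnInterval F₁ a b) (h₂ : AbsolutelyContinuousOnInterval F₂ a b)
    (h : ∀ x ∈ uIcc a b, ∀ y ∈ uIcc a b, dist (w x) (w y) ≤
      dist (F₁ x) (F₁ y) + dist (F₂ x) (F₂ y)) :
    AbsolutelyContinuousOnInterval w a b := by
  have h12 := Tendsto.add h₁ h₂
  rw [add_zero] at h12
  refine squeeze_zero' (Eventually.of_forall fun E => Finset.sum_nonneg fun _ _ => dist_nonneg)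
    ?_ h12
  filter_upwards [mem_inf_of_right (mem_principal_self _)] with E hE
  rw [← Finset.sum_add_distrib]
  exact Finset.sum_le_sum fun i hi => h _ (hE.1 i hi).1 _ (hE.1 i hi).2

/-- An indefinite integral is absolutely continuous. -/
lemma absolutelyContinuousOnInterval_of_integral {f w : ℝ → ℂ} {T : ℝ} (hT : 0 ≤ T)
    (hf : IntervalIntegrable f volume 0 T)
    (hw : ∀ t ∈ Icc 0 T, w t - w 0 = ∫ s in (0 : ℝ)..t, f s) :
    AbsolutelyContinuousOnInterval w 0 T := by
  have hre : IntervalIntegrable (fun t => (f t).re) volume 0 T :=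
    ⟨hf.1.re, hf.2.re⟩
  have him : IntervalIntegrable (fun t => (f t).im) volume 0 T :=
    ⟨hf.1.im, hf.2.im⟩
  refine absolutelyContinuousOnInterval_of_dist_le
    (hre.absolutelyContinuousOnInterval_intervalIntegral (c := 0) (by simp))
    (him.absolutelyContinuousOnInterval_intervalIntegral (c := 0) (by simp)) ?_
  have hi : ∀ t ∈ Icc 0 T, IntegrableOn f (Ioc 0 t) := fun t ht =>
    hf.1.mono_set (Ioc_subset_Ioc_right ht.2)
  have hr : ∀ t ∈ Icc 0 T, ∫ s in (0 : ℝ)..t, (f s).re = (w t - w 0).re := by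
    intro t ht
    rw [hw t ht, intervalIntegral.integral_of_le ht.1, intervalIntegral.integral_of_le ht.1]
    exact integral_re (hi t ht)
  have hm : ∀ t ∈ Icc 0 T, ∫ s in (0 : ℝ)..t, (f s).im = (w t - w 0).im := by
    intro t ht
    rw [hw t ht, intervalIntegral.integral_of_le ht.1, intervalIntegral.integral_of_le ht.1]
    exact integral_im (hi t ht)
  rw [uIcc_of_le hT]
  intro x hx y hy
  simp only [hr x hx, hr y hy, hm x hx, hm y hy, dist_eq_norm]
  have h := Complex.norm_le_abs_re_add_abs_im (w x - w y)
  simpa [Complex.sub_re, Complex.sub_im] using h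

/-- An absolutely continuous function is an indefinite integral. -/
lemma exists_lapBdd_of_absolutelyContinuous {w : ℝ → ℂ} {T : ℝ} (hT : 0 ≤ T)
    (hw : AbsolutelyContinuousOnInterval w 0 T) {σ : ℝ} (hσ : 0 < σ) :
    ∃ f, LapBdd σ f ∧ ∀ t ∈ Icc 0 T, w t - w 0 = ∫ s in (0 : ℝ)..t, f s := by
  have hre : AbsolutelyContinuousOnInterval (fun t => (w t).re) 0 T := by
    refine absolutelyContinuousOnInterval_of_dist_le hw hw fun x _ y _ => ?_
    rw [Real.dist_eq, ← Complex.sub_re, dist_eq_norm]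
    have := Complex.abs_re_le_norm (w x - w y)
    linarith [norm_nonneg (w x - w y)]
  have him : AbsolutelyContinuousOnInterval (fun t => (w t).im) 0 T := by
    refine absolutelyContinuousOnInterval_of_dist_le hw hw fun x _ y _ => ?_
    rw [Real.dist_eq, ← Complex.sub_im, dist_eq_norm]
    have := Complex.abs_im_le_norm (w x - w y)
    linarith [norm_nonneg (w x - w y)]
  set g : ℝ → ℂ := fun t => ((deriv (fun t => (w t).re) t : ℝ) : ℂ) +
    ((deriv (fun t => (w t).im) t : ℝ) : ℂ) * Complex.I with hg
  have hd1 : Measurable (deriv fun t => (w t).re) := measurable_deriv _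
  have hd2 : Measurable (deriv fun t => (w t).im) := measurable_deriv _
  have hgm : Measurable g := by fun_prop
  have hri := hre.intervalIntegrable_deriv
  have hii := him.intervalIntegrable_deriv
  have hgi : IntegrableOn g (Ioc 0 T) := hri.1.ofReal.add (hii.1.ofReal.mul_const _)
  -- Cutting off to (0, T] gives a function in L¹(ℝ) vanishing for t ≤ 0; the weight is at most 1
  -- there, so any σ > 0 works.
  refine ⟨(Ioc 0 T).indicator g, ⟨(hgm.indicator measurableSet_Ioc).stronglyMeasurable,
    fun t ht => ?_, hσ, ?_⟩, fun t ht => ?_⟩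
  · exact indicator_of_notMem (fun h => absurd h.1 (not_lt.2 ht)) _
  · have hfin : ∫⁻ t, ‖(Ioc 0 T).indicator g t‖ₑ ≠ ⊤ :=
      ((integrable_indicator_iff measurableSet_Ioc).2 hgi).2.ne
    refine ne_top_of_le_ne_top hfin (lintegral_mono fun t => ?_)
    by_cases ht : t ∈ Ioc 0 T
    · refine mul_le_of_le_one_right zero_le ?_
      rw [← ENNReal.ofReal_one]
      refine ENNReal.ofReal_le_ofReal (Real.exp_le_one_iff.2 ?_)
      have := ht.1
      nlinarith
    · simp [ht]
  · have hsub : uIcc 0 t ⊆ uIcc 0 T := by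
      rw [uIcc_of_le ht.1, uIcc_of_le hT]
      exact Icc_subset_Icc_right ht.2
    have h1 := (hre.mono hsub).integral_deriv_eq_sub
    have h2 := (him.mono hsub).integral_deriv_eq_sub
    have h3 : ∫ s in (0 : ℝ)..t, (Ioc 0 T).indicator g s = ∫ s in (0 : ℝ)..t, g s := by
      rw [intervalIntegral.integral_of_le ht.1, intervalIntegral.integral_of_le ht.1]
      refine setIntegral_congr_fun measurableSet_Ioc fun s hs => ?_
      have hsT : s ∈ Ioc 0 T := ⟨hs.1, hs.2.trans ht.2⟩
      rw [indicator_of_mem hsT]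
    have hr' := (hre.mono hsub).intervalIntegrable_deriv
    have hi' := (him.mono hsub).intervalIntegrable_deriv
    have hr2 : IntervalIntegrable (fun s => ((deriv (fun t => (w t).re) s : ℝ) : ℂ)) volume 0 t :=
      ⟨hr'.1.ofReal, hr'.2.ofReal⟩
    have hi2 : IntervalIntegrable (fun s => ((deriv (fun t => (w t).im) s : ℝ) : ℂ)) volume 0 t :=
      ⟨hi'.1.ofReal, hi'.2.ofReal⟩
    rw [h3, hg, intervalIntegral.integral_add hr2 (hi2.mul_const _),
      intervalIntegral.integral_mul_const, intervalIntegral.integral_ofReal,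
      intervalIntegral.integral_ofReal, h1, h2]
    apply Complex.ext <;> simp

/-- An indefinite integral is weakly differentiable. -/
lemma hasWeakDerivL1_of_integral {T : ℝ} {w f : ℝ → ℂ} (hf : IntegrableOn f (Ioo 0 T)) (c : ℂ)
    (hw : ∀ t ∈ Ioo 0 T, w t = c + ∫ s in (0 : ℝ)..t, f s) : HasWeakDerivL1 T w f := by
  rcases le_or_gt T 0 with hT | hT
  · have : Ioo (0 : ℝ) T = ∅ := Ioo_eq_empty (not_lt.2 hT)
    refine ⟨by simp [this], by simp [this], fun φ _ _ _ => by simp [this]⟩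
  have hfI : IntervalIntegrable f volume 0 T := by
    rw [intervalIntegrable_iff_integrableOn_Ioo_of_le hT.le]; exact hf
  have hcont : ContinuousOn (fun t => ∫ s in (0 : ℝ)..t, f s) (uIcc 0 T) :=
    intervalIntegral.continuousOn_primitive_interval
      ((intervalIntegrable_iff_integrableOn_Icc_of_le hT.le).1 hfI |>.mono_set
        (by rw [uIcc_of_le hT.le]))
  have hUI : IntegrableOn (fun t => c + ∫ s in (0 : ℝ)..t, f s) (Ioo 0 T) := by
    rw [uIcc_of_le hT.le] at hcont
    exact ((continuousOn_const.add hcont).integrableOn_Icc).mono_set Ioo_subset_Icc_self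
  refine ⟨hUI.congr_fun (fun t ht => (hw t ht).symm) measurableSet_Ioo, hf, fun φ hφ hcs hsupp => ?_⟩
  have hφ0 : φ 0 = 0 := by
    by_contra h
    exact absurd (hsupp (subset_tsupport φ h)).1 (lt_irrefl _)
  have hφT : φ T = 0 := by
    by_contra h
    exact absurd (hsupp (subset_tsupport φ h)).2 (lt_irrefl _)
  have hφd : ∀ x, HasDerivAt φ (deriv φ x) x := fun x =>
    (hφ.differentiable (by simp) x).hasDerivAt
  have hφc : Continuous (deriv φ) := hφ.continuous_deriv (by simp)
  have hprim : ∀ a b, ∫ s in a..b, deriv φ s = φ b - φ a := fun a b =>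
    intervalIntegral.integral_eq_sub_of_hasDerivAt (fun x _ => hφd x)
      (hφc.intervalIntegrable _ _)
  have hlhs : ∫ t in Ioo 0 T, deriv φ t • w t =
      ∫ t in Ioo 0 T, deriv φ t • (c + ∫ s in (0 : ℝ)..t, f s) :=
    setIntegral_congr_fun measurableSet_Ioo fun t ht => by simp only [hw t ht]
  obtain ⟨M, hM⟩ := (isCompact_Icc (a := (0 : ℝ)) (b := T)).exists_bound_of_continuousOn
    hφc.continuousOn
  have hdI : IntegrableOn (deriv φ) (Ioo 0 T) :=
    (hφc.integrableOn_Icc).mono_set Ioo_subset_Icc_self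
  -- Integration by parts as Fubini on the triangle s < t: the inner integral of φ' over (s, T) is
  -- -φ(s).
  have hfub : Integrable (fun p : ℝ × ℝ => {p : ℝ × ℝ | p.2 < p.1}.indicator
      (fun p => deriv φ p.1 • f p.2) p)
      ((volume.restrict (Ioo 0 T)).prod (volume.restrict (Ioo 0 T))) :=
    (Integrable.smul_prod hdI hf).indicator (measurableSet_lt measurable_snd measurable_fst)
  have hswap := integral_integral_swap
    (f := fun t s => {p : ℝ × ℝ | p.2 < p.1}.indicator (fun p => deriv φ p.1 • f p.2) (t, s)) hfub
  have hinner1 : ∀ t ∈ Ioo 0 T, ∫ s in Ioo 0 T, {p : ℝ × ℝ | p.2 < p.1}.indicator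
      (fun p => deriv φ p.1 • f p.2) (t, s) = deriv φ t • ∫ s in (0 : ℝ)..t, f s := by
    intro t ht
    rw [← intervalIntegral.integral_smul, intervalIntegral.integral_of_le ht.1.le,
      integral_Ioc_eq_integral_Ioo, ← integral_indicator measurableSet_Ioo,
      ← integral_indicator measurableSet_Ioo]
    refine integral_congr_ae (Eventually.of_forall fun s => ?_)
    by_cases h1 : s ∈ Ioo 0 t
    · have h2 : s ∈ Ioo 0 T := ⟨h1.1, h1.2.trans ht.2⟩
      simp [h1, h2, h1.2]
    · by_cases h2 : s ∈ Ioo 0 T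
      · have h3 : ¬ s < t := fun h => h1 ⟨h2.1, h⟩
        simp [h1, h2, h3]
      · simp [h1, h2]
  have hinner2 : ∀ s ∈ Ioo 0 T, ∫ t in Ioo 0 T, {p : ℝ × ℝ | p.2 < p.1}.indicator
      (fun p => deriv φ p.1 • f p.2) (t, s) = -(φ s • f s) := by
    intro s hs
    have h0 : (∫ t in s..T, deriv φ t) • f s = -(φ s • f s) := by
      rw [hprim, hφT, zero_sub, neg_smul]
    rw [← h0, ← intervalIntegral.integral_smul_const, intervalIntegral.integral_of_le hs.2.le,
      integral_Ioc_eq_integral_Ioo, ← integral_indicator measurableSet_Ioo,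
      ← integral_indicator measurableSet_Ioo]
    refine integral_congr_ae (Eventually.of_forall fun t => ?_)
    by_cases h1 : t ∈ Ioo s T
    · have h2 : t ∈ Ioo 0 T := ⟨hs.1.trans h1.1, h1.2⟩
      simp [h1, h2, h1.1]
    · by_cases h2 : t ∈ Ioo 0 T
      · have h3 : ¬ s < t := fun h => h1 ⟨h, h2.2⟩
        simp [h1, h2, h3]
      · simp [h1, h2]
  rw [setIntegral_congr_fun measurableSet_Ioo hinner1,
    setIntegral_congr_fun measurableSet_Ioo hinner2, integral_neg] at hswap
  rw [hlhs, ← hswap]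
  have hF : IntegrableOn (fun t => deriv φ t • ∫ s in (0 : ℝ)..t, f s) (Ioo 0 T) := by
    refine IntegrableOn.mono_set (t := Icc 0 T) ?_ Ioo_subset_Icc_self
    rw [uIcc_of_le hT.le] at hcont
    exact (hφc.continuousOn.smul hcont).integrableOn_Icc
  -- The constant c contributes c(φ(T) - φ(0)) = 0.
  simp_rw [smul_add]
  rw [integral_add (hdI.smul_const c) hF, integral_smul_const, ← integral_Ioc_eq_integral_Ioo,
    ← intervalIntegral.integral_of_le hT.le, hprim, hφ0, hφT]
  simp

/-- Pointwise |w| ≤ ‖f‖₁, which costs a factor T after integration; the 1 accounts for the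
derivative itself. -/
lemma w11Norm_le_of_integral {T : ℝ} {w f : ℝ → ℂ}
    (hf : ∫⁻ t in Ioo 0 T, ‖f t‖ₑ ≠ ⊤) (hfm : AEStronglyMeasurable f (volume.restrict (Ioo 0 T)))
    (hw : ∀ t ∈ Ioo 0 T, w t = ∫ s in (0 : ℝ)..t, f s) :
    w11Norm T w ≤ (ENNReal.ofReal T + 1) * ∫⁻ t in Ioo 0 T, ‖f t‖ₑ := by
  have hd : HasWeakDerivL1 T w f :=
    hasWeakDerivL1_of_integral ⟨hfm, hf.lt_top⟩ 0 (fun t ht => by rw [hw t ht, zero_add])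
  refine (iInf₂_le f hd).trans ?_
  rw [add_mul, one_mul]
  gcongr
  calc ∫⁻ t in Ioo 0 T, ‖w t‖ₑ ≤ ∫⁻ _ in Ioo 0 T, (∫⁻ s in Ioo 0 T, ‖f s‖ₑ) := by
        refine setLIntegral_mono' measurableSet_Ioo fun t ht => ?_
        rw [hw t ht, intervalIntegral.integral_of_le ht.1.le, integral_Ioc_eq_integral_Ioo]
        exact (enorm_integral_le_lintegral_enorm _).trans
          (lintegral_mono_set (Ioo_subset_Ioo_right ht.2.le))
    _ = _ := by rw [setLIntegral_const, Real.volume_Ioo, sub_zero, mul_comm]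

end

/-! ### The resolvent kernel and the series solution. -/

section

/-- For a nonnegative integrand, Bochner integral and `toReal` of the Lebesgue integral agree even
in the divergent case, so no convergence is checked here. -/
lemma resolventKernel_eq {μ : ℝ → ℝ} [OrderMeasure (orderMeasure μ)]
    (hμ_int : IntegrableOn μ (Ioo (0 : ℝ) 1))
    (hμ_nonneg : ∀ᵐ α ∂(volume.restrict (Ioo (0 : ℝ) 1)), 0 ≤ μ α) {t : ℝ} (ht : 0 < t) :
    resolventKernel μ t = (resKer (orderMeasure μ) t).toReal := by
  have hm := measurable_resDens (orderMeasure μ)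
  have hnn : ∀ r, 0 ≤ resDens (orderMeasure μ) r := fun r => (specDens_pos _ _).le
  have hS : ∀ r : ℝ, 0 < r → ∫ α in Ioo (0 : ℝ) 1, Real.sin (Real.pi * α) * r ^ α * μ α =
      sinT (orderMeasure μ) (Real.log r) := by
    intro r hr
    rw [sinT, integral_orderMeasure hμ_int hμ_nonneg]
    refine integral_congr_ae (Eventually.of_forall fun α => ?_)
    simp only [smul_eq_mul]
    rw [Real.rpow_def_of_pos hr, mul_comm (Real.log r)]
    ring
  have hC : ∀ r : ℝ, 0 < r → ∫ α in Ioo (0 : ℝ) 1, Real.cos (Real.pi * α) * r ^ α * μ α =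
      cosT (orderMeasure μ) (Real.log r) := by
    intro r hr
    rw [cosT, integral_orderMeasure hμ_int hμ_nonneg]
    refine integral_congr_ae (Eventually.of_forall fun α => ?_)
    simp only [smul_eq_mul]
    rw [Real.rpow_def_of_pos hr, mul_comm (Real.log r)]
    ring
  rw [resKer, indicator_of_mem (show t ∈ Ioi (0 : ℝ) from ht), resolventKernel,
    ← integral_eq_lintegral_of_nonneg_ae, integral_const_mul]
  · congr 1
    refine setIntegral_congr_fun measurableSet_Ioi fun r hr => ?_
    rw [hS r hr, hC r hr]
    rfl
  · refine Eventually.of_forall fun r => ?_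
    have := hnn r
    have := Real.pi_pos
    simp only [Pi.zero_apply]
    positivity
  · exact (by fun_prop : Measurable _).aestronglyMeasurable

lemma integrableOn_resolventKernel {μ : ℝ → ℝ} [OrderMeasure (orderMeasure μ)]
    (hμ_int : IntegrableOn μ (Ioo (0 : ℝ) 1))
    (hμ_nonneg : ∀ᵐ α ∂(volume.restrict (Ioo (0 : ℝ) 1)), 0 ≤ μ α) (T : ℝ) :
    IntegrableOn (resolventKernel μ) (Ioo 0 T) := by
  have hm := measurable_resKer (orderMeasure μ)
  have h : ∫⁻ t in Ioo 0 T, resKer (orderMeasure μ) t ≠ ⊤ := by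
    refine ne_top_of_le_ne_top (resIter_ne_top (orderMeasure μ) 1 T) ?_
    rw [resIter, lconv_heav_eq]
    exact lintegral_mono_set Ioo_subset_Iio_self
  have hi : IntegrableOn (fun t => (resKer (orderMeasure μ) t).toReal) (Ioo 0 T) :=
    integrable_toReal_of_lintegral_ne_top hm.aemeasurable h
  exact hi.congr_fun
    (fun t ht => (resolventKernel_eq hμ_int hμ_nonneg ht.1).symm) measurableSet_Ioo

section Series

variable {μ : ℝ → ℝ}

lemma seriesTerm_zero (lam : ℂ) (t : ℝ) : seriesTerm μ lam 0 t = 1 := by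
  simp [seriesTerm, iterConv]

lemma seriesTerm_eq [OrderMeasure (orderMeasure μ)] (hμ_int : IntegrableOn μ (Ioo (0 : ℝ) 1))
    (hμ_nonneg : ∀ᵐ α ∂(volume.restrict (Ioo (0 : ℝ) 1)), 0 ≤ μ α) (lam : ℂ) (k : ℕ) {t : ℝ}
    (ht : 0 < t) :
    seriesTerm μ lam k t = (-lam) ^ k * ((resIter (orderMeasure μ) k t).toReal : ℂ) := by
  rw [seriesTerm, iterConv_eq_resIter (orderMeasure μ)
    (fun _ => resolventKernel_eq hμ_int hμ_nonneg) k ht]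

lemma seriesTerm_succ [OrderMeasure (orderMeasure μ)] (hμ_int : IntegrableOn μ (Ioo (0 : ℝ) 1))
    (hμ_nonneg : ∀ᵐ α ∂(volume.restrict (Ioo (0 : ℝ) 1)), 0 ≤ μ α) (lam : ℂ) (k : ℕ) {t : ℝ}
    (ht : 0 ≤ t) :
    seriesTerm μ lam (k + 1) t = ∫ s in (0 : ℝ)..t, derivTerm (orderMeasure μ) lam k s := by
  rcases ht.eq_or_lt with rfl | ht
  · simp [seriesTerm, iterConv_succ_zero]
  · rw [seriesTerm_eq hμ_int hμ_nonneg lam _ ht, integral_derivTerm]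

lemma summable_seriesTerm [OrderMeasure (orderMeasure μ)]
    (hμ_int : IntegrableOn μ (Ioo (0 : ℝ) 1))
    (hμ_nonneg : ∀ᵐ α ∂(volume.restrict (Ioo (0 : ℝ) 1)), 0 ≤ μ α) {lam : ℂ} {σ q : ℝ}
    (h : SmallAt (orderMeasure μ) lam σ q) {t : ℝ} (ht : 0 ≤ t) :
    Summable fun k => seriesTerm μ lam k t := by
  rcases ht.eq_or_lt with rfl | ht
  · refine summable_of_ne_finset_zero (s := {0}) fun k hk => ?_
    obtain ⟨j, rfl⟩ := Nat.exists_eq_succ_of_ne_zero (by simpa using hk)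
    simp [seriesTerm, iterConv_succ_zero]
  · refine Summable.of_norm_bounded
      ((summable_geometric_two).mul_left (Real.exp (σ * t))) fun k => ?_
    rw [seriesTerm_eq hμ_int hμ_nonneg lam k ht, norm_mul, norm_pow, norm_neg, Complex.norm_real,
      Real.norm_of_nonneg ENNReal.toReal_nonneg]
    calc ‖lam‖ ^ k * (resIter (orderMeasure μ) k t).toReal
        ≤ ‖lam‖ ^ k * (Real.exp (σ * t) * q ^ k) := by
          gcongr
          exact resIter_toReal_le h.pos.le h.q_pos.le h.lap_eq k t
      _ = Real.exp (σ * t) * (‖lam‖ * q) ^ k := by rw [mul_pow]; ring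
      _ ≤ Real.exp (σ * t) * (1 / 2) ^ k := by
          have := h.q_pos
          gcongr
          exact h.small

/-- Termwise integration, valid at every t ≥ 0. This one formula supplies the initial value,
absolute continuity and the derivative of the sum. -/
lemma seriesSum_eq [OrderMeasure (orderMeasure μ)]
    (hμ_int : IntegrableOn μ (Ioo (0 : ℝ) 1))
    (hμ_nonneg : ∀ᵐ α ∂(volume.restrict (Ioo (0 : ℝ) 1)), 0 ≤ μ α) {lam : ℂ} {σ q : ℝ}
    (h : SmallAt (orderMeasure μ) lam σ q) {t : ℝ} (ht : 0 ≤ t) :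
    seriesSum μ lam t = 1 + ∫ s in (0 : ℝ)..t, derivSum (orderMeasure μ) lam s := by
  rw [seriesSum, (summable_seriesTerm hμ_int hμ_nonneg h ht).tsum_eq_zero_add, seriesTerm_zero]
  congr 1
  unfold derivSum
  rw [integral_tsum_of_lapBdd (fun k => lapBdd_derivTerm _ h.pos lam k) h.tsum_lap_ne_top]
  exact tsum_congr fun k => seriesTerm_succ hμ_int hμ_nonneg lam k ht

lemma SmallAt.tsum_lintegral_ne_top {ν : Measure ℝ} [OrderMeasure ν] {lam : ℂ} {σ q : ℝ}
    (h : SmallAt ν lam σ q) (T : ℝ) :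
    ∑' k, ∫⁻ t in Ioo 0 T, ‖derivTerm ν lam k t‖ₑ ≠ ⊤ := by
  refine ne_top_of_le_ne_top
    (tsum_heav_lconv_ne_top (fun k => lapBdd_derivTerm ν h.pos lam k) h.tsum_lap_ne_top T)
    (ENNReal.tsum_le_tsum fun k => ?_)
  rw [lconvolution_comm, lconv_heav_eq]
  exact lintegral_mono_set Ioo_subset_Iio_self

lemma tsum_w11Norm_lt_top [OrderMeasure (orderMeasure μ)]
    (hμ_int : IntegrableOn μ (Ioo (0 : ℝ) 1))
    (hμ_nonneg : ∀ᵐ α ∂(volume.restrict (Ioo (0 : ℝ) 1)), 0 ≤ μ α) {lam : ℂ} {σ q : ℝ}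
    (h : SmallAt (orderMeasure μ) lam σ q) (T : ℝ) :
    ∑' k, w11Norm T (seriesTerm μ lam k) < ⊤ := by
  have hB := h.tsum_lintegral_ne_top T
  rw [tsum_eq_zero_add' ENNReal.summable]
  refine ENNReal.add_lt_top.2 ⟨?_, ?_⟩
  -- The constant term is not an integral starting from 0, so it is estimated separately.
  · have hd : HasWeakDerivL1 T (seriesTerm μ lam 0) fun _ => 0 :=
      hasWeakDerivL1_of_integral integrableOn_zero 1 fun t _ => by simp [seriesTerm_zero]
    refine (iInf₂_le _ hd).trans_lt ?_
    simp [seriesTerm_zero]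
  · refine lt_of_le_of_lt (b := ∑' k, (ENNReal.ofReal T + 1) *
      ∫⁻ t in Ioo 0 T, ‖derivTerm (orderMeasure μ) lam k t‖ₑ)
      (ENNReal.tsum_le_tsum fun k => ?_) ?_
    · exact w11Norm_le_of_integral (ENNReal.ne_top_of_tsum_ne_top hB k)
        (lapBdd_derivTerm _ h.pos lam k).meas.aestronglyMeasurable
        fun t ht => seriesTerm_succ hμ_int hμ_nonneg lam k ht.1.le
    · rw [ENNReal.tsum_mul_left]
      exact ENNReal.mul_lt_top (by simp) hB.lt_top

lemma tendsto_w11Norm_remainder [OrderMeasure (orderMeasure μ)]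
    (hμ_int : IntegrableOn μ (Ioo (0 : ℝ) 1))
    (hμ_nonneg : ∀ᵐ α ∂(volume.restrict (Ioo (0 : ℝ) 1)), 0 ≤ μ α) {lam : ℂ} {σ q : ℝ}
    (h : SmallAt (orderMeasure μ) lam σ q) (T : ℝ) :
    Tendsto (fun n : ℕ => w11Norm T (fun t => seriesSum μ lam t -
      ∑ k ∈ Finset.range n, seriesTerm μ lam k t)) atTop (𝓝 0) := by
  have hB := h.tsum_lintegral_ne_top T
  have hd := fun k => lapBdd_derivTerm (orderMeasure μ) h.pos lam k
  have hdS := h.lapBdd_derivSum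
  -- With at least one term subtracted the constant 1 cancels, and the remainder is a primitive
  -- vanishing at 0.
  rw [← tendsto_add_atTop_iff_nat 1]
  have hlim : Tendsto (fun m : ℕ => (ENNReal.ofReal T + 1) *
      ∑' k, ∫⁻ t in Ioo 0 T, ‖derivTerm (orderMeasure μ) lam (k + m) t‖ₑ) atTop (𝓝 0) := by
    have h1 := ENNReal.Tendsto.const_mul (a := ENNReal.ofReal T + 1)
      (ENNReal.tendsto_sum_nat_add _ hB) (Or.inr (by simp))
    rwa [mul_zero] at h1
  refine tendsto_of_tendsto_of_tendsto_of_le_of_le tendsto_const_nhds hlim (fun _ => zero_le)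
    fun m => ?_
  set f : ℝ → ℂ := fun t => derivSum (orderMeasure μ) lam t -
    ∑ k ∈ Finset.range m, derivTerm (orderMeasure μ) lam k t with hf
  have hle : ∫⁻ t in Ioo 0 T, ‖f t‖ₑ ≤
      ∑' k, ∫⁻ t in Ioo 0 T, ‖derivTerm (orderMeasure μ) lam (k + m) t‖ₑ := by
    rw [← lintegral_tsum fun k => (hd (k + m)).measurable_enorm.aemeasurable]
    refine lintegral_mono_ae ?_
    filter_upwards [ae_restrict_of_ae (ae_tsum_enorm_ne_top hd h.tsum_lap_ne_top)] with t ht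
    have hs : Summable fun k => derivTerm (orderMeasure μ) lam k t :=
      Summable.of_norm (tsum_enorm_ne_top_iff_summable_norm.1 ht)
    have : f t = ∑' k, derivTerm (orderMeasure μ) lam (k + m) t := by
      simp only [hf, derivSum]
      rw [← hs.sum_add_tsum_nat_add m, add_sub_cancel_left]
    rw [this]
    exact enorm_tsum_le_tsum_enorm
  have hne : ∫⁻ t in Ioo 0 T, ‖f t‖ₑ ≠ ⊤ := by
    refine ne_top_of_le_ne_top (ne_top_of_le_ne_top hB ?_) hle
    exact ENNReal.tsum_comp_le_tsum_of_injective (add_left_injective m) _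
  have hfm : Measurable f :=
    hdS.meas.measurable.sub (Finset.measurable_fun_sum _ fun k _ => (hd k).meas.measurable)
  refine (w11Norm_le_of_integral hne hfm.aestronglyMeasurable fun t ht => ?_).trans (by gcongr)
  have hsi : IntervalIntegrable (fun s => ∑ k ∈ Finset.range m,
      derivTerm (orderMeasure μ) lam k s) volume 0 t := by
    have := IntervalIntegrable.sum (Finset.range m) (a := 0) (b := t) (μ := volume)
      fun k _ => (hd k).intervalIntegrable 0 t
    simpa only [Finset.sum_fn] using this
  simp only [hf]
  rw [intervalIntegral.integral_sub (hdS.intervalIntegrable _ _) hsi,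
    intervalIntegral.integral_finsetSum fun k _ => (hd k).intervalIntegrable _ _,
    seriesSum_eq hμ_int hμ_nonneg h ht.1.le, Finset.sum_range_succ', seriesTerm_zero]
  simp_rw [seriesTerm_succ hμ_int hμ_nonneg lam _ ht.1.le]
  ring

/-- Convolving termwise with k sends the derivative of term k+1 to -λ times term k; countably many
null sets are discarded. -/
lemma ae_cconv_derivSum [OrderMeasure (orderMeasure μ)]
    (hμ_int : IntegrableOn μ (Ioo (0 : ℝ) 1))
    (hμ_nonneg : ∀ᵐ α ∂(volume.restrict (Ioo (0 : ℝ) 1)), 0 ≤ μ α) {lam : ℂ} {σ q : ℝ}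
    (h : SmallAt (orderMeasure μ) lam σ q) :
    ∀ᵐ t, 0 < t → cconv (capKer (orderMeasure μ)) (derivSum (orderMeasure μ) lam) t =
      -lam * seriesSum μ lam t := by
  have hd := fun k => lapBdd_derivTerm (orderMeasure μ) h.pos lam k
  have hK := measurable_capKer (orderMeasure μ)
  have hl : lap (capKer (orderMeasure μ)) σ ≠ ⊤ := by
    rw [lap_capKer _ h.pos]; exact ENNReal.ofReal_ne_top
  filter_upwards [ae_tsum_lconv_lt_top hd h.tsum_lap_ne_top hK hl,
    ae_all_iff.2 fun k => capKer_lconv_resPow (orderMeasure μ) k] with t h1 h2 ht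
  unfold derivSum
  rw [cconv_tsum hd hK h1.ne, seriesSum, ← tsum_mul_left]
  refine tsum_congr fun k => ?_
  rw [cconv_derivTerm _ hK, h2 k, seriesTerm_eq hμ_int hμ_nonneg lam k ht, pow_succ]
  · ring
  · rw [h2 k]; exact resIter_ne_top _ k t

end Series

/-! ### Uniqueness. -/

/-- Uniqueness for the homogeneous equation. -/
lemma integral_eq_zero_of_cconv_eq {ν : Measure ℝ} [OrderMeasure ν] {lam : ℂ} {σ q : ℝ}
    (h : SmallAt ν lam σ q) {u : ℝ → ℂ} (hu : LapBdd σ u) {T : ℝ}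
    (heq : ∀ᵐ t ∂(volume.restrict (Ioo 0 T)),
      cconv (capKer ν) u t = -lam * ∫ s in (0 : ℝ)..t, u s) :
    ∀ t ∈ Icc 0 T, ∫ s in (0 : ℝ)..t, u s = 0 := by
  have hG := measurable_resKer ν
  have hK := measurable_capKer ν
  set U : ℝ → ℂ := fun t => ∫ s in (0 : ℝ)..t, u s with hU
  have hUc : Continuous U := intervalIntegral.continuous_primitive hu.intervalIntegrable 0
  -- Convolving the equation with g and using g * k = 1 gives U = -λ g * U at every point of [0, T].
  have hrep : ∀ t ∈ Icc 0 T, U t = ∫ s in Ioo 0 t, (resKer ν (t - s)).toReal • (-lam * U s) := by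
    intro t ht
    have hGK : (resKer ν ⋆ₗ capKer ν) =ᵐ[volume] heav := by
      rw [lconvolution_comm]; exact capKer_lconv_resKer ν
    have hsh : ∀ᵐ s, (resKer ν ⋆ₗ capKer ν) (t - s) = heav (t - s) :=
      (quasiMeasurePreserving_sub_left_of_right_invariant volume t).ae hGK
    -- Replacing g * k by the Heaviside function under the integral gives finiteness for every t,
    -- not merely almost every t.
    have hfin : ((resKer ν ⋆ₗ capKer ν) ⋆ₗ fun s => ‖u s‖ₑ) t ≠ ⊤ := by
      have h1 : ((resKer ν ⋆ₗ capKer ν) ⋆ₗ fun s => ‖u s‖ₑ) t =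
          (heav ⋆ₗ fun s => ‖u s‖ₑ) t := by
        rw [lconv_eq_sub, lconv_eq_sub]
        refine lintegral_congr_ae ?_
        filter_upwards [hsh] with s hs
        rw [hs]
      rw [h1, lconvolution_comm]
      exact ne_top_of_le_ne_top (ENNReal.mul_ne_top ENNReal.ofReal_ne_top hu.fin)
        (lconv_heav_le hu.measurable_enorm hu.pos.le t)
    have hA := cconv_assoc hG hK hu.meas.aestronglyMeasurable hfin
    have hB : cconv (resKer ν ⋆ₗ capKer ν) u t = U t := by
      change _ = ∫ s in (0 : ℝ)..t, u s
      rw [← cconv_heav hu.zero]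
      refine integral_congr_ae ?_
      filter_upwards [hsh] with s hs
      rw [hs]
    rw [← hB, ← hA, cconv_eq_intervalIntegral (fun _ => resKer_of_nonpos ν)
      (fun s hs => cconv_of_nonpos (fun _ => capKer_of_nonpos ν) hu.zero hs) ht.1,
      intervalIntegral.integral_of_le ht.1, integral_Ioc_eq_integral_Ioo]
    refine integral_congr_ae ?_
    filter_upwards [ae_restrict_of_ae_restrict_of_subset (Ioo_subset_Ioo_right ht.2) heq]
      with s hs
    rw [hs]
  intro t₁ ht₁
  -- In the weighted sup norm U ↦ -λ g * U contracts by |λ| q ≤ 1/2, which forces the maximum M to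
  -- be 0.
  obtain ⟨t₀, ht₀, hmax⟩ := (isCompact_Icc (a := (0 : ℝ)) (b := T)).exists_isMaxOn ⟨t₁, ht₁⟩
    (f := fun t => Real.exp (-(σ * t)) * ‖U t‖) (by fun_prop)
  set M := Real.exp (-(σ * t₀)) * ‖U t₀‖ with hM
  have hM0 : 0 ≤ M := by positivity
  have hbd : ∀ t ∈ Icc 0 T, ‖U t‖ ≤ M * Real.exp (σ * t) := by
    intro t ht
    have h1 : Real.exp (-(σ * t)) * ‖U t‖ ≤ M := hmax ht
    rw [Real.exp_neg, inv_mul_le_iff₀ (Real.exp_pos _)] at h1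
    linarith
  have hmain : ‖U t₀‖ₑ ≤ ENNReal.ofReal (‖lam‖ * M * Real.exp (σ * t₀) * q) := by
    calc ‖U t₀‖ₑ ≤ ∫⁻ s in Ioo 0 t₀, ‖(resKer ν (t₀ - s)).toReal • (-lam * U s)‖ₑ := by
          rw [hrep t₀ ht₀]
          exact enorm_integral_le_lintegral_enorm _
      _ ≤ ∫⁻ s in Ioo 0 t₀, ENNReal.ofReal (‖lam‖ * M * Real.exp (σ * t₀)) *
            (resKer ν (t₀ - s) * ENNReal.ofReal (Real.exp (-(σ * (t₀ - s))))) := by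
          refine setLIntegral_mono' measurableSet_Ioo fun s hs => ?_
          have h1 : ‖(resKer ν (t₀ - s)).toReal‖ₑ ≤ resKer ν (t₀ - s) := by
            rw [Real.enorm_of_nonneg ENNReal.toReal_nonneg]
            exact ENNReal.ofReal_toReal_le
          have h2 : ‖-lam * U s‖ₑ ≤ ENNReal.ofReal (‖lam‖ * M * Real.exp (σ * t₀)) *
              ENNReal.ofReal (Real.exp (-(σ * (t₀ - s)))) := by
            rw [← ENNReal.ofReal_mul (by positivity), mul_assoc _ (Real.exp (σ * t₀)),
              ← Real.exp_add, ← ofReal_norm, norm_mul, norm_neg, mul_assoc]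
            refine ENNReal.ofReal_le_ofReal ?_
            gcongr
            rw [show σ * t₀ + -(σ * (t₀ - s)) = σ * s by ring]
            exact hbd s ⟨hs.1.le, hs.2.le.trans ht₀.2⟩
          rw [enorm_smul]
          refine (mul_le_mul' h1 h2).trans_eq ?_
          ring
      _ ≤ ∫⁻ s, ENNReal.ofReal (‖lam‖ * M * Real.exp (σ * t₀)) *
            (resKer ν (t₀ - s) * ENNReal.ofReal (Real.exp (-(σ * (t₀ - s))))) :=
          setLIntegral_le_lintegral _ _
      _ = ENNReal.ofReal (‖lam‖ * M * Real.exp (σ * t₀)) * lap (resKer ν) σ := by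
          rw [lintegral_sub_left_eq_self (fun s => ENNReal.ofReal (‖lam‖ * M * Real.exp (σ * t₀)) *
            (resKer ν s * ENNReal.ofReal (Real.exp (-(σ * s))))) t₀,
            lintegral_const_mul _ (by fun_prop)]
          rfl
      _ = _ := by rw [h.lap_eq, ← ENNReal.ofReal_mul (by positivity)]
  have hq := h.q_pos
  rw [← ofReal_norm, ENNReal.ofReal_le_ofReal_iff (by positivity)] at hmain
  have hMle : M ≤ M / 2 := by
    have h1 : ‖U t₀‖ = M * Real.exp (σ * t₀) := by
      rw [hM, mul_right_comm, ← Real.exp_add]; simp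
    rw [h1, show ‖lam‖ * M * Real.exp (σ * t₀) * q = (‖lam‖ * q * M) * Real.exp (σ * t₀) by ring]
      at hmain
    have h2 := le_of_mul_le_mul_right hmain (Real.exp_pos _)
    have h3 := mul_le_mul_of_nonneg_right h.small hM0
    linarith
  have hMz : M = 0 := by linarith
  have h1 := hbd t₁ ht₁
  rw [hMz, zero_mul] at h1
  exact norm_le_zero_iff.1 h1

lemma LapBdd.sub {σ : ℝ} {f₁ f₂ : ℝ → ℂ} (h₁ : LapBdd σ f₁) (h₂ : LapBdd σ f₂) :
    LapBdd σ fun t => f₁ t - f₂ t := by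
  refine ⟨h₁.meas.sub h₂.meas, fun t ht => by rw [h₁.zero t ht, h₂.zero t ht, sub_zero], h₁.pos, ?_⟩
  have hm₁ := h₁.measurable_enorm
  refine ne_top_of_le_ne_top (ENNReal.add_ne_top.2 ⟨h₁.fin, h₂.fin⟩) ?_
  unfold lap
  rw [← lintegral_add_left (by fun_prop)]
  refine lintegral_mono fun t => ?_
  rw [← add_mul]
  gcongr
  exact enorm_sub_le

lemma LapBdd.const_mul {σ : ℝ} {f : ℝ → ℂ} (h : LapBdd σ f) (c : ℂ) :
    LapBdd σ fun t => c * f t := by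
  have hm := h.measurable_enorm
  refine ⟨h.meas.const_mul c, fun t ht => by rw [h.zero t ht, mul_zero], h.pos, ?_⟩
  have : lap (fun t => ‖c * f t‖ₑ) σ = ‖c‖ₑ * lap (fun t => ‖f t‖ₑ) σ := by
    unfold lap
    rw [← lintegral_const_mul _ (by fun_prop)]
    exact lintegral_congr fun t => by
      simp only [enorm_mul, mul_assoc]
  rw [this]
  exact ENNReal.mul_ne_top (by simp) h.fin

lemma cconv_const_mul (A : ℝ → ℝ≥0∞) (f : ℝ → ℂ) (c : ℂ) (t : ℝ) :
    cconv A (fun s => c * f s) t = c * cconv A f t := by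
  unfold cconv
  rw [← integral_const_mul]
  exact integral_congr_ae (Eventually.of_forall fun s => by
    simp only [Complex.real_smul]; ring)

/-- Only almost everywhere, since both convolution integrals must converge absolutely. -/
lemma LapBdd.ae_cconv_sub {σ : ℝ} {f₁ f₂ : ℝ → ℂ} (h₁ : LapBdd σ f₁) (h₂ : LapBdd σ f₂)
    {A : ℝ → ℝ≥0∞} (hA : Measurable A) (hlA : lap A σ ≠ ⊤) :
    ∀ᵐ t, DistOrder.cconv A (fun s => f₁ s - f₂ s) t =
      DistOrder.cconv A f₁ t - DistOrder.cconv A f₂ t := by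
  filter_upwards [ae_lconv_lt_top hA h₁.measurable_enorm hlA h₁.fin,
    ae_lconv_lt_top hA h₂.measurable_enorm hlA h₂.fin] with t ht₁ ht₂
  unfold DistOrder.cconv
  rw [← integral_sub (cconv_integrand_integrable hA h₁.meas.aestronglyMeasurable ht₁.ne)
    (cconv_integrand_integrable hA h₂.meas.aestronglyMeasurable ht₂.ne)]
  simp_rw [smul_sub]

end

end

end DistOrder

/-! ### The main theorem. -/

theorem proposition1 (μ : ℝ → ℝ)
    (hμ_int : IntegrableOn μ (Ioo (0 : ℝ) 1))
    (hμ_nonneg : ∀ᵐ α ∂(volume.restrict (Ioo (0 : ℝ) 1)), 0 ≤ μ α)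
    (hμ_pos : 0 < ∫ α in Ioo (0 : ℝ) 1, μ α)
    (v₀ lam : ℂ) :
    -- the kernel is locally integrable on `[0,∞)`
    (∀ T : ℝ, 0 < T → IntegrableOn (DistOrder.resolventKernel μ) (Ioo (0 : ℝ) T)) ∧
    -- the series converges pointwise, absolutely in `W^{1,1}(0,T)`, and to its sum in that space
    (∀ t : ℝ, 0 ≤ t → Summable (fun k : ℕ => DistOrder.seriesTerm μ lam k t)) ∧
    (∀ T : ℝ, 0 < T →
      ∑' k : ℕ, DistOrder.w11Norm T (DistOrder.seriesTerm μ lam k) < ⊤ ∧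
      Tendsto (fun n : ℕ => DistOrder.w11Norm T (fun t => DistOrder.seriesSum μ lam t -
        ∑ k ∈ Finset.range n, DistOrder.seriesTerm μ lam k t)) atTop (𝓝 0)) ∧
    -- `v = v₀ ∑ₖ (-lam)^k g^[k] * 1` is an absolutely continuous solution on `[0,∞)`,
    -- its distributed order derivative being defined almost everywhere
    (∀ T : ℝ, 0 < T →
      DistOrder.IsACSolution μ lam v₀ T (fun t => v₀ * DistOrder.seriesSum μ lam t) ∧
      ∀ᵐ t ∂(volume.restrict (Ioo (0 : ℝ) T)),
        DistOrder.DistCaputoDefinedAt μ (fun t => v₀ * DistOrder.seriesSum μ lam t) t) ∧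
    -- uniqueness on every interval `[0,T]`, hence also on `[0,∞)`
    (∀ T : ℝ, 0 < T → ∀ w : ℝ → ℂ, DistOrder.IsACSolution μ lam v₀ T w →
      EqOn w (fun t => v₀ * DistOrder.seriesSum μ lam t) (Icc (0 : ℝ) T)) := by
  open DistOrder in
  have hν : OrderMeasure (orderMeasure μ) :=
    orderMeasure_isOrderMeasure hμ_int hμ_nonneg hμ_pos
  -- One σ, depending only on μ and |λ|, serves existence and uniqueness on all intervals.
  obtain ⟨σ, hσ, q, hq, hsmall, hlap⟩ := exists_lap_resKer_le (orderMeasure μ) ‖lam‖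
  have h : SmallAt (orderMeasure μ) lam σ q := ⟨hσ, hq, hsmall, hlap⟩
  have hK := measurable_capKer (orderMeasure μ)
  have hKl : lap (capKer (orderMeasure μ)) σ ≠ ⊤ := by
    rw [lap_capKer _ hσ]; exact ENNReal.ofReal_ne_top
  set v : ℝ → ℂ := fun t => v₀ * seriesSum μ lam t with hv
  set d : ℝ → ℂ := fun t => v₀ * derivSum (orderMeasure μ) lam t with hd
  have hdB : LapBdd σ d := h.lapBdd_derivSum.const_mul v₀
  have hv0 : v 0 = v₀ := by
    simp only [hv]
    rw [seriesSum_eq hμ_int hμ_nonneg h le_rfl, intervalIntegral.integral_same, add_zero, mul_one]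
  have hvd : ∀ t, 0 ≤ t → v t - v 0 = ∫ s in (0 : ℝ)..t, d s := by
    intro t ht
    rw [hv0, hd, intervalIntegral.integral_const_mul]
    simp only [hv]
    rw [seriesSum_eq hμ_int hμ_nonneg h ht]
    ring
  have hKd : ∀ᵐ t, 0 < t → cconv (capKer (orderMeasure μ)) d t = -lam * v t := by
    filter_upwards [ae_cconv_derivSum hμ_int hμ_nonneg h] with t ht h0
    rw [hd, cconv_const_mul, ht h0, hv]
    ring
  refine ⟨fun T _ => integrableOn_resolventKernel hμ_int hμ_nonneg T,
    fun t ht => summable_seriesTerm hμ_int hμ_nonneg h ht,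
    fun T _ => ⟨tsum_w11Norm_lt_top hμ_int hμ_nonneg h T,
      tendsto_w11Norm_remainder hμ_int hμ_nonneg h T⟩, fun T hT => ?_, fun T hT w hw => ?_⟩
  · have hae := ae_distCaputo_eq hμ_int hμ_nonneg hdB (T := T) fun t ht => hvd t ht.1
    refine ⟨⟨absolutelyContinuousOnInterval_of_integral hT.le (hdB.intervalIntegrable _ _)
      fun t ht => hvd t ht.1, hv0, ?_⟩, hae.mono fun t ht => ht.1⟩
    filter_upwards [hae, ae_restrict_of_ae hKd, ae_restrict_mem measurableSet_Ioo] with t h1 h2 ht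
    rw [h1.2, h2 ht.1]
    ring
  · obtain ⟨f, hf, hwf⟩ := exists_lapBdd_of_absolutelyContinuous hT.le hw.ac hσ
    have hae := ae_distCaputo_eq hμ_int hμ_nonneg hf hwf
    have hdiff : ∀ t ∈ Icc 0 T, w t - v t = ∫ s in (0 : ℝ)..t, (f s - d s) := by
      intro t ht
      rw [intervalIntegral.integral_sub (hf.intervalIntegrable _ _) (hdB.intervalIntegrable _ _),
        ← hwf t ht, ← hvd t ht.1, hw.init, hv0]
      ring
    -- Subtracting the equations of w and v gives k * (f - d) = -λ (w - v), and w - v is the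
    -- primitive of f - d because the initial values agree.
    have hz := integral_eq_zero_of_cconv_eq h (hf.sub hdB) (T := T) (by
      filter_upwards [hae, hw.eqn, ae_restrict_of_ae hKd,
        ae_restrict_of_ae (hf.ae_cconv_sub hdB hK hKl), ae_restrict_mem measurableSet_Ioo]
        with t h1 h2 h3 h4 ht
      rw [h4, ← hdiff t (Ioo_subset_Icc_self ht), h3 ht.1, ← h1.2]
      linear_combination h2)
    intro t ht
    have := hdiff t ht
    rw [hz t ht] at this
    exact sub_eq_zero.1 this
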